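/- **Notation.** Let $k,m,N$ be positive integers with $m$ square-free and let $\chi$ be a Dirichlet character modulo $mN$, regarded as the character $\begin{pmatrix}a&b\\c&d\end{pmatrix}\mapsto\chi(d)$ of $\Gamma_0(mN)$. Write $e(x)=e^{2\pi i x}$. For $r\ge 0$ put $$\theta^J_{m,r}(\tau,z)=\sum_{n\in\mathbb Z}e\Big(m\big((n+\tfrac r{2m})^2\tau+2(n+\tfrac r{2m})z\big)\Big)\qquad(\tau\in\mathbb H,\ z\in\mathbb C).$$ For $\gamma=\begin{pmatrix}a&b\\c&d\end{pmatrix}\in SL_2(\mathbb Z)$ let $U_1(\gamma)$ be the unique complex $2\times2$ matrix with $$\begin{pmatrix}\theta^J_{1,0}\\ \theta^J_{1,1}\end{pmatrix}\Big(\frac{a\tau+b}{c\tau+d},\frac z{c\tau+d}\Big)=e\Big(\frac{cz^2}{c\tau+d}\Big)(c\tau+d)^{1/2}\,U_1(\gamma)\begin{pmatrix}\theta^J_{1,0}\\ \theta^J_{1,1}\end{pmatrix}(\tau,z)$$ (principal square root). For $\gamma=\begin{pmatrix}a&b\\c&d\end{pmatrix}\in\Gamma_0(m)$ let $\omega_m(\gamma)=\det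 U_1\begin{pmatrix}a&mb\\c/m&d\end{pmatrix}$; this is a character of $\Gamma_0(m)$. Put $\omega=\omega_1$. On $\Gamma_0(mN)$, $\omega_m$ and $\omega$ denote the restrictions. For a character $\nu$ of $\Gamma_0(M)$ and a positive integer $m$: * $M_{k}(\Gamma_0(M),\nu)$ is the space of holomorphic $f:\mathbb H\to\mathbb C$ with $f(\gamma\tau)=\nu(\gamma)(c\tau+d)^{k}f(\tau)$ for all $\gamma\in\Gamma_0(M)$ that are holomorphic at all cusps, i.e. $(c\tau+d)^{-k}f(g\tau)$ is bounded as $\operatorname{Im}\tau\to\infty$ for every $g=\begin{pmatrix}a&b\\c&d\end{pmatrix}\in SL_2(\mathbb Z)$. * $J_{k,m}(\Gamma_0(M),\nu)$ is the space of Jacobi forms of weight $k$, index $m$ and character $\nu$: holomorphic $\phi:\mathbb H\times\mathbb C\to\mathbb C$ such that $\phi|_{k,m}\gamma=\nu(\gamma)\phi$ for $\gamma\in\Gamma_0(M)$, where $(\phi|_{k,m}\gamma)(\tau,z)=(c\tau+d)^{-k}e\big(-\tfrac{mcz^2}{c\tau+d}\big)\phi\big(\tfrac{a\tau+b}{c\tau+d},\tfrac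 z{c\tau+d}\big)$; such that $\phi(\tau,z+\lambda\tau+\mu)=e(-m(\lambda^2\tau+2\lambda z))\phi(\tau,z)$ for $\lambda,\mu\in\mathbb Z$; and such that for every $g\in SL_2(\mathbb Z)$ there are an integer $h\ge1$ and coefficients $c(n,r)$ with $(\phi|_{k,m}g)(\tau,z)=\sum_{n,r\in\mathbb Z}c(n,r)\,e(\tfrac nh\tau+rz)$ and $c(n,r)=0$ unless $r^2\le 4m\tfrac nh$. * $J_{k,m}(\Gamma_0(M),\nu)^0$ is the subspace of those $\phi\in J_{k,m}(\Gamma_0(M),\nu)$ with $\phi(\tau,0)=0$ for all $\tau$, i.e. the kernel of the restriction map $D_0:\phi(\tau,z)\mapsto\phi(\tau,0)$. * $J^*_{k,m}(\Gamma_0(M),\nu)$ is the subspace of those $\phi\in J_{k,m}(\Gamma_0(M),\nu)$ whose theta decomposition $\phi(\tau,z)=\sum_{r=0}^{2m-1}h_{m,r}(\tau)\theta^J_{m,r}(\tau,z)$ has $h_{m,r}=0$ for all $r\ne0,m$, and $J^*_{k,m}(\Gamma_0(M),\nu)^0=J^*_{k,m}(\Gamma_0(M),\nu)\cap J_{k,m}(\Gamma_0(M),\nu)^0$.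 **Corollary 4.5.** The two kernel spaces $$J_{k,1}(\Gamma_0(mN),\chi)^0\qquad\text{and}\qquad J^*_{k,m}(\Gamma_0(mN),\chi\,\omega_m\overline\omega)^0$$ are isomorphic as complex vector spaces. Moreover each of them is isomorphic, as a complex vector space, to $M_{k-1}(\Gamma_0(mN),\chi\overline\omega)$. -/

import Mathlib

open UpperHalfPlane CongruenceSubgroup
open scoped MatrixGroups Manifold ModularForm Real

namespace JacobiRestriction

noncomputable section

/-! ## Theta functions and the factor of automorphy -/

/-- The automorphy factor `c τ + d` of `γ = (a, b; c, d)`. -/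
def autFactor (γ : SL(2, ℤ)) (τ : ℍ) : ℂ := (γ 1 0 : ℂ) * (τ : ℂ) + (γ 1 1 : ℂ)

/-- The theta function
`θ^J_{m,r}(τ, z) = ∑_{n ∈ ℤ} exp (2 π i m ((n + r / 2m)² τ + 2 (n + r / 2m) z))`. -/
def theta (m r : ℕ) (τ : ℍ) (z : ℂ) : ℂ :=
  ∑' n : ℤ, Complex.exp (2 * π * Complex.I * m *
    (((n : ℂ) + (r : ℂ) / (2 * m)) ^ 2 * (τ : ℂ) + 2 * ((n : ℂ) + (r : ℂ) / (2 * m)) * z))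

/-- The column vector `(θ^J_{1,0}, θ^J_{1,1})`. -/
def thetaVec (τ : ℍ) (z : ℂ) : Fin 2 → ℂ := ![theta 1 0 τ z, theta 1 1 τ z]

/-- `U` describes the transformation of the index one theta vector under `γ`:
`Θ^J(γ(τ, z)) = exp (2 π i c z² / (c τ + d)) (c τ + d)^{1/2} U Θ^J(τ, z)`
with the principal branch of the square root. -/
def IsThetaMultiplier (γ : SL(2, ℤ)) (U : Matrix (Fin 2) (Fin 2) ℂ) : Prop :=
  ∀ (τ : ℍ) (z : ℂ), thetaVec (γ • τ) (z / autFactor γ τ) =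
    (Complex.exp (2 * π * Complex.I * ((γ 1 0 : ℂ) * z ^ 2 / autFactor γ τ)) *
      autFactor γ τ ^ (1 / 2 : ℂ)) • U.mulVec (thetaVec τ z)

/-! ### Existence and uniqueness of the theta multiplier -/

lemma autFactor_eq_denom (γ : SL(2, ℤ)) (τ : ℍ) : autFactor γ τ = denom γ τ := by
  simp [autFactor, ModularGroup.denom_apply]

lemma autFactor_ne_zero (γ : SL(2, ℤ)) (τ : ℍ) : autFactor γ τ ≠ 0 := by
  rw [autFactor_eq_denom]; exact denom_ne_zero _ _

lemma coe_smul_mul_autFactor (γ : SL(2, ℤ)) (τ : ℍ) :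
    ((γ • τ : ℍ) : ℂ) * autFactor γ τ = (γ 0 0 : ℂ) * τ + (γ 0 1 : ℂ) := by
  have h := autFactor_ne_zero γ τ
  rw [coe_specialLinearGroup_apply]
  simp only [autFactor] at *
  simp only [algebraMap_int_eq, eq_intCast, Complex.ofReal_intCast]
  exact div_mul_cancel₀ _ h

lemma autFactor_mul (γ δ : SL(2, ℤ)) (τ : ℍ) :
    autFactor (γ * δ) τ = autFactor γ (δ • τ) * autFactor δ τ := by
  have h := coe_smul_mul_autFactor δ τ
  have e : autFactor γ (δ • τ) * autFactor δ τ =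
      (γ 1 0 : ℂ) * (((δ • τ : ℍ) : ℂ) * autFactor δ τ) + (γ 1 1 : ℂ) * autFactor δ τ := by
    simp only [autFactor]; ring
  rw [e, h]
  simp only [autFactor, Matrix.SpecialLinearGroup.coe_mul, Matrix.mul_apply, Fin.sum_univ_two]
  push_cast
  ring

lemma continuous_autFactor (γ : SL(2, ℤ)) : Continuous (autFactor γ) := by
  unfold autFactor
  fun_prop

lemma sqrt_sq (w : ℂ) : (w ^ (1 / 2 : ℂ)) ^ 2 = w := by
  have := Complex.cpow_nat_inv_pow w (n := 2) two_ne_zero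
  simpa only [one_div, Nat.cast_ofNat] using this

lemma sqrt_ne_zero {w : ℂ} (hw : w ≠ 0) : w ^ (1 / 2 : ℂ) ≠ 0 := by
  intro h
  apply hw
  rw [← sqrt_sq w, h]
  simp

/-- A continuous function on the upper half-plane with constant nonzero square is constant. -/
lemma const_of_sq {q : ℍ → ℂ} (hq : Continuous q) {c : ℂ} (hc : c ≠ 0) (h : ∀ τ, q τ ^ 2 = c) :
    ∃ κ : ℂ, κ ^ 2 = c ∧ ∀ τ, q τ = κ := by
  refine ⟨q I, h I, fun τ => ?_⟩
  have hne : q I ≠ 0 := fun h0 => hc (by rw [← h I, h0]; simp)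
  have := isPreconnected_univ.eq_or_eq_neg_of_sq_eq (f := q) (g := fun _ => q I)
    hq.continuousOn continuousOn_const (fun x _ => by simp [h]) (fun {x} _ => hne)
  rcases this with h1 | h1
  · exact h1 (Set.mem_univ τ)
  · have := h1 (Set.mem_univ I)
    simp only [Pi.neg_apply] at this
    exact absurd (self_eq_neg.mp this) hne

lemma continuous_sqrt_autFactor (γ : SL(2, ℤ)) :
    Continuous (fun τ : ℍ => autFactor γ τ ^ (1 / 2 : ℂ)) := by
  by_cases hc : γ 1 0 = 0
  · have : ∀ τ, autFactor γ τ = (γ 1 1 : ℂ) := fun τ => by simp [autFactor, hc]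
    simp only [this]
    exact continuous_const
  · refine continuous_iff_continuousAt.mpr fun τ => ?_
    refine (continuous_autFactor γ).continuousAt.cpow continuousAt_const ?_
    right
    have : (autFactor γ τ).im = γ 1 0 * τ.im := by simp [autFactor]
    rw [this]
    exact mul_ne_zero (by exact_mod_cast hc) τ.im_ne_zero

lemma isThetaMultiplier_mul {γ δ : SL(2, ℤ)} {U V : Matrix (Fin 2) (Fin 2) ℂ}
    (hU : IsThetaMultiplier γ U) (hV : IsThetaMultiplier δ V) :
    ∃ ε : ℂ, ε ^ 2 = 1 ∧ IsThetaMultiplier (γ * δ) (ε • (U * V)) := by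
  have hδ : Continuous fun τ : ℍ => δ • τ :=
    continuous_const_smul (Matrix.SpecialLinearGroup.mapGL ℝ δ)
  obtain ⟨ε, hε, h⟩ := const_of_sq (q := fun τ : ℍ =>
      autFactor γ (δ • τ) ^ (1 / 2 : ℂ) * autFactor δ τ ^ (1 / 2 : ℂ) /
        autFactor (γ * δ) τ ^ (1 / 2 : ℂ))
    ((((continuous_sqrt_autFactor γ).comp hδ).mul (continuous_sqrt_autFactor δ)).div
      (continuous_sqrt_autFactor _) fun τ => sqrt_ne_zero (autFactor_ne_zero _ _))
    one_ne_zero (fun τ => by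
      have := autFactor_ne_zero (γ * δ) τ
      rw [div_pow, mul_pow, sqrt_sq, sqrt_sq, sqrt_sq, ← autFactor_mul, div_self this])
  refine ⟨ε, hε, fun τ z => ?_⟩
  have e1 : z / autFactor (γ * δ) τ = z / autFactor δ τ / autFactor γ (δ • τ) := by
    rw [autFactor_mul, div_div, mul_comm]
  have h1 := (div_eq_iff (sqrt_ne_zero (autFactor_ne_zero (γ * δ) τ))).mp (h τ)
  rw [e1, mul_smul, hU, hV, Matrix.mulVec_smul, smul_smul, Matrix.smul_mulVec, smul_smul,
    Matrix.mulVec_mulVec]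
  congr 1
  have e2 : (γ 1 0 : ℂ) * (z / autFactor δ τ) ^ 2 / autFactor γ (δ • τ) +
      (δ 1 0 : ℂ) * z ^ 2 / autFactor δ τ =
      ((γ * δ) 1 0 : ℂ) * z ^ 2 / autFactor (γ * δ) τ := by
    have d1 := autFactor_ne_zero γ (δ • τ)
    have d2 := autFactor_ne_zero δ τ
    have key : (γ 1 0 : ℂ) + (δ 1 0 : ℂ) * autFactor (γ * δ) τ =
        ((γ * δ) 1 0 : ℂ) * autFactor δ τ := by
      have hdet : (δ 0 0 : ℂ) * δ 1 1 - δ 0 1 * δ 1 0 = 1 := by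
        have := Matrix.det_fin_two δ.1
        rw [δ.2] at this
        exact_mod_cast this.symm
      simp only [autFactor, Matrix.SpecialLinearGroup.coe_mul, Matrix.mul_apply,
        Fin.sum_univ_two]
      push_cast
      linear_combination (-(γ 1 0 : ℂ)) * hdet
    rw [autFactor_mul] at key ⊢
    field_simp
    linear_combination z ^ 2 * key
  rw [← e2, mul_add, Complex.exp_add, mul_assoc _ _ ε, mul_comm _ ε, ← h1]
  ring

lemma isThetaMultiplier_one : IsThetaMultiplier 1 1 := by
  intro τ z
  simp [autFactor]

lemma theta_zero_eq (τ : ℍ) (z : ℂ) : theta 1 0 τ z = jacobiTheta₂ (2 * z) (2 * τ) := by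
  unfold theta jacobiTheta₂ jacobiTheta₂_term
  refine tsum_congr fun n => ?_
  congr 1
  push_cast
  ring

lemma theta_one_eq (τ : ℍ) (z : ℂ) : theta 1 1 τ z =
    Complex.exp (π * Complex.I * τ / 2 + 2 * π * Complex.I * z) *
      jacobiTheta₂ (2 * z + τ) (2 * τ) := by
  unfold theta jacobiTheta₂ jacobiTheta₂_term
  rw [← tsum_mul_left]
  refine tsum_congr fun n => ?_
  rw [← Complex.exp_add]
  congr 1
  push_cast
  ring

lemma theta_add (τ : ℍ) (z : ℂ) : theta 1 0 τ z + theta 1 1 τ z = jacobiTheta₂ z (τ / 2) := by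
  have hτ : 0 < ((τ : ℂ) / 2).im := by
    have := τ.im_pos
    simp only [Complex.div_ofNat_im, coe_im]; positivity
  have h2τ : 0 < (2 * (τ : ℂ)).im := by simpa using τ.im_pos
  have hs := hasSum_jacobiTheta₂_term z hτ
  have h0 := hasSum_jacobiTheta₂_term (2 * z) h2τ
  have h1 := (hasSum_jacobiTheta₂_term (2 * z + τ) h2τ).mul_left
    (Complex.exp (π * Complex.I * τ / 2 + 2 * π * Complex.I * z))
  rw [theta_zero_eq, theta_one_eq]
  refine HasSum.unique ?_ hs
  have hc : IsCompl (Set.range fun n : ℤ => 2 * n) (Set.range fun n : ℤ => 2 * n + 1) := by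
    rw [range_two_mul, range_two_mul_add_one]
    exact Int.isCompl_even_odd
  have hi0 : Function.Injective fun n : ℤ => 2 * n := fun a b h => by simpa using h
  have hi1 : Function.Injective fun n : ℤ => 2 * n + 1 := fun a b h => by simpa using h
  refine HasSum.add_isCompl hc ?_ ?_
  · rw [Function.comp_def, Function.Injective.hasSum_range_iff (f := fun n => jacobiTheta₂_term n z (τ / 2)) hi0]
    refine h0.congr_fun fun n => ?_
    simp only [Function.comp_apply, jacobiTheta₂_term]
    congr 1
    push_cast
    ring
  · rw [Function.comp_def, Function.Injective.hasSum_range_iff (f := fun n => jacobiTheta₂_term n z (τ / 2)) hi1]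
    refine h1.congr_fun fun n => ?_
    simp only [Function.comp_apply, jacobiTheta₂_term]
    rw [← Complex.exp_add]
    congr 1
    push_cast
    ring

lemma theta_add' (τ : ℍ) (z : ℂ) :
    theta 1 0 τ (z + 1 / 2) = theta 1 0 τ z ∧ theta 1 1 τ (z + 1 / 2) = - theta 1 1 τ z := by
  constructor
  · rw [theta_zero_eq, theta_zero_eq, mul_add, mul_one_div_cancel two_ne_zero,
      jacobiTheta₂_add_left]
  · rw [theta_one_eq, theta_one_eq, show 2 * (z + 1 / 2) + (τ : ℂ) = 2 * z + τ + 1 by ring,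
      jacobiTheta₂_add_left, show π * Complex.I * τ / 2 + 2 * π * Complex.I * (z + 1 / 2) =
        (π * Complex.I * τ / 2 + 2 * π * Complex.I * z) + π * Complex.I by ring, Complex.exp_add,
      Complex.exp_pi_mul_I]
    ring

lemma exists_isThetaMultiplier_S : ∃ U, IsThetaMultiplier ModularGroup.S U := by
  have haut : ∀ τ : ℍ, autFactor ModularGroup.S τ = τ := fun τ => by
    simp [autFactor, ModularGroup.S]
  have hS : ∀ τ : ℍ, ((ModularGroup.S • τ : ℍ) : ℂ) = -1 / τ := fun τ => by
    rw [modular_S_smul]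
    simp [neg_div, inv_neg]
  have hτ0 : ∀ τ : ℍ, (τ : ℂ) ≠ 0 := fun τ => ne_zero τ
  have hslit : ∀ (a : ℝ) (τ : ℍ), 0 < a → -Complex.I * (a * (τ : ℂ)) ∈ Complex.slitPlane := by
    intro a τ ha
    left
    have := τ.im_pos
    simpa using mul_pos ha this
  -- the ratio of the two square roots occurring in the inversion formula is constant
  have hratio : ∀ a : ℝ, 0 < a → ∃ κ : ℂ, ∀ τ : ℍ,
      (-Complex.I * (a * (τ : ℂ))) ^ (1 / 2 : ℂ) = κ * (τ : ℂ) ^ (1 / 2 : ℂ) := by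
    intro a ha
    have hcont := continuous_sqrt_autFactor ModularGroup.S
    simp only [haut] at hcont
    obtain ⟨κ, -, h⟩ := const_of_sq
      (q := fun τ : ℍ => (-Complex.I * (a * (τ : ℂ))) ^ (1 / 2 : ℂ) / (τ : ℂ) ^ (1 / 2 : ℂ))
      (c := -Complex.I * a)
      (Continuous.div (continuous_iff_continuousAt.mpr fun τ =>
        ContinuousAt.cpow (by fun_prop) continuousAt_const (hslit a τ ha)) hcont
          fun τ => sqrt_ne_zero (hτ0 τ))
      (by simp [ha.ne']) (fun τ => by
        have := hτ0 τ
        rw [div_pow, sqrt_sq, sqrt_sq]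
        field_simp)
    exact ⟨κ, fun τ => (div_eq_iff (sqrt_ne_zero (hτ0 τ))).mp (h τ)⟩
  obtain ⟨κ, hκ⟩ := hratio (1 / 2) (by norm_num)
  obtain ⟨μ, hμ⟩ := hratio 2 (by norm_num)
  have h0 : ∀ (τ : ℍ) (z : ℂ), theta 1 0 (ModularGroup.S • τ) (z / τ) =
      κ * (τ : ℂ) ^ (1 / 2 : ℂ) * Complex.exp (2 * π * Complex.I * (z ^ 2 / τ)) *
        (theta 1 0 τ z + theta 1 1 τ z) := by
    intro τ z
    have hne : (-Complex.I * ((τ : ℂ) / 2)) ^ (1 / 2 : ℂ) ≠ 0 :=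
      sqrt_ne_zero (by simp [hτ0])
    have hroot : (-Complex.I * ((τ : ℂ) / 2)) ^ (1 / 2 : ℂ) = κ * (τ : ℂ) ^ (1 / 2 : ℂ) := by
      rw [← hκ τ]; congr 2; push_cast; ring
    rw [theta_add, jacobiTheta₂_functional_equation z (τ / 2), theta_zero_eq, hS, ← hroot]
    have hexp : Complex.exp (2 * π * Complex.I * (z ^ 2 / τ)) *
        Complex.exp (-π * Complex.I * z ^ 2 / (τ / 2)) = 1 := by
      rw [← Complex.exp_add, Complex.exp_eq_one_iff]
      refine ⟨0, ?_⟩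
      have := hτ0 τ
      field_simp
      ring
    have e1 : z / ((τ : ℂ) / 2) = 2 * (z / τ) := by have := hτ0 τ; field_simp
    have e2 : -1 / ((τ : ℂ) / 2) = 2 * (-1 / τ) := by have := hτ0 τ; field_simp
    rw [e1, e2]
    have hinv := mul_one_div_cancel hne
    linear_combination (-(jacobiTheta₂ (2 * (z / τ)) (2 * (-1 / τ)))) *
      (((-Complex.I * ((τ : ℂ) / 2)) ^ (1 / 2 : ℂ) *
        (1 / (-Complex.I * ((τ : ℂ) / 2)) ^ (1 / 2 : ℂ))) * hexp + hinv)
  have h1 : ∀ (τ : ℍ) (z : ℂ), theta 1 0 (ModularGroup.S • τ) (z / τ) +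
      theta 1 1 (ModularGroup.S • τ) (z / τ) =
      μ * (τ : ℂ) ^ (1 / 2 : ℂ) * Complex.exp (2 * π * Complex.I * (z ^ 2 / τ)) *
        theta 1 0 τ z := by
    intro τ z
    have hne : (-Complex.I * (2 * (τ : ℂ))) ^ (1 / 2 : ℂ) ≠ 0 :=
      sqrt_ne_zero (by simp [hτ0])
    have hroot : (-Complex.I * (2 * (τ : ℂ))) ^ (1 / 2 : ℂ) = μ * (τ : ℂ) ^ (1 / 2 : ℂ) := by
      rw [← hμ τ]; congr 2
    rw [theta_add, theta_zero_eq, jacobiTheta₂_functional_equation (2 * z) (2 * τ), hS, ← hroot]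
    have hexp : Complex.exp (2 * π * Complex.I * (z ^ 2 / τ)) *
        Complex.exp (-π * Complex.I * (2 * z) ^ 2 / (2 * τ)) = 1 := by
      rw [← Complex.exp_add, Complex.exp_eq_one_iff]
      refine ⟨0, ?_⟩
      have := hτ0 τ
      field_simp
      ring
    have e1 : 2 * z / (2 * (τ : ℂ)) = z / τ := by have := hτ0 τ; field_simp
    have e2 : -1 / (2 * (τ : ℂ)) = -1 / τ / 2 := by have := hτ0 τ; field_simp
    rw [e1, e2]
    have hinv := mul_one_div_cancel hne
    linear_combination (-(jacobiTheta₂ (z / τ) (-1 / τ / 2))) *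
      (((-Complex.I * (2 * (τ : ℂ))) ^ (1 / 2 : ℂ) *
        (1 / (-Complex.I * (2 * (τ : ℂ))) ^ (1 / 2 : ℂ))) * hexp + hinv)
  refine ⟨!![κ, κ; μ - κ, -κ], fun τ z => ?_⟩
  have hc : ((ModularGroup.S 1 0 : ℤ) : ℂ) = 1 := by simp [ModularGroup.S]
  have h1' := h1 τ z
  have h2 := eq_sub_of_add_eq' h1'
  rw [haut, hc, one_mul, thetaVec, h2, h0]
  ext i
  fin_cases i
  · simp [thetaVec]
    ring
  · simp [thetaVec]
    ring

lemma exists_isThetaMultiplier_T_zpow (k : ℤ) :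
    ∃ U, IsThetaMultiplier (ModularGroup.T ^ k) U := by
  have haut : ∀ τ : ℍ, autFactor (ModularGroup.T ^ k) τ = 1 := fun τ => by
    simp [autFactor, ModularGroup.coe_T_zpow]
  refine ⟨!![1, 0; 0, Complex.exp (2 * π * Complex.I * (k / 4))], fun τ z => ?_⟩
  have hc : (((ModularGroup.T ^ k) 1 0 : ℤ) : ℂ) = 0 := by simp [ModularGroup.coe_T_zpow]
  rw [haut, hc, div_one, thetaVec]
  have hper : ∀ n : ℤ, Complex.exp (2 * π * Complex.I * n) = 1 := fun n => by
    rw [Complex.exp_eq_one_iff]; exact ⟨n, by ring⟩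
  have h0 : theta 1 0 (ModularGroup.T ^ k • τ) z = theta 1 0 τ z := by
    unfold theta
    refine tsum_congr fun n => ?_
    rw [ModularGroup.coe_T_zpow_smul_eq]
    rw [← mul_one (Complex.exp (_ * (_ * (τ : ℂ) + _))), ← hper (n ^ 2 * k), ← Complex.exp_add]
    congr 1
    push_cast
    ring
  have h1 : theta 1 1 (ModularGroup.T ^ k • τ) z =
      Complex.exp (2 * π * Complex.I * (k / 4)) * theta 1 1 τ z := by
    unfold theta
    rw [← tsum_mul_left]
    refine tsum_congr fun n => ?_
    rw [ModularGroup.coe_T_zpow_smul_eq]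
    rw [← one_mul (Complex.exp (2 * π * Complex.I * (k / 4)) * _), ← hper ((n ^ 2 + n) * k),
      ← Complex.exp_add, ← Complex.exp_add]
    congr 1
    push_cast
    ring
  rw [h0, h1]
  ext i
  fin_cases i
  · simp [thetaVec]
  · simp [thetaVec]
    ring

lemma exists_isThetaMultiplier (γ : SL(2, ℤ)) : ∃ U, IsThetaMultiplier γ U := by
  have hmul : ∀ γ δ : SL(2, ℤ), (∃ U, IsThetaMultiplier γ U) → (∃ U, IsThetaMultiplier δ U) →
      ∃ U, IsThetaMultiplier (γ * δ) U := by
    rintro γ δ ⟨U, hU⟩ ⟨V, hV⟩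
    obtain ⟨ε, -, h⟩ := isThetaMultiplier_mul hU hV
    exact ⟨_, h⟩
  have hγ : γ ∈ Subgroup.closure {ModularGroup.S, ModularGroup.T} := by
    rw [SpecialLinearGroup.SL2Z_generators]; trivial
  induction hγ using Subgroup.closure_induction'' with
  | one => exact ⟨1, isThetaMultiplier_one⟩
  | mem x hx =>
    rcases hx with rfl | rfl
    · exact exists_isThetaMultiplier_S
    · simpa using exists_isThetaMultiplier_T_zpow 1
  | inv_mem x hx =>
    rcases hx with rfl | rfl
    · have : ModularGroup.S⁻¹ = ModularGroup.S * (ModularGroup.S * ModularGroup.S) := by decide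
      rw [this]
      exact hmul _ _ exists_isThetaMultiplier_S
        (hmul _ _ exists_isThetaMultiplier_S exists_isThetaMultiplier_S)
    · simpa using exists_isThetaMultiplier_T_zpow (-1)
  | mul x y _ _ hx hy => exact hmul x y hx hy

lemma hasSum_theta_zero (τ : ℍ) (z : ℂ) :
    Summable fun n : ℤ => Complex.exp (2 * π * Complex.I * (1 : ℕ) *
      (((n : ℂ) + ((0 : ℕ) : ℂ) / (2 * (1 : ℕ))) ^ 2 * (τ : ℂ) +
        2 * ((n : ℂ) + ((0 : ℕ) : ℂ) / (2 * (1 : ℕ))) * z)) := by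
  have h2τ : 0 < (2 * (τ : ℂ)).im := by simpa using τ.im_pos
  refine ((hasSum_jacobiTheta₂_term (2 * z) h2τ).summable).congr fun n => ?_
  unfold jacobiTheta₂_term
  congr 1
  push_cast
  ring

lemma hasSum_theta_one (τ : ℍ) (z : ℂ) :
    Summable fun n : ℤ => Complex.exp (2 * π * Complex.I * (1 : ℕ) *
      (((n : ℂ) + ((1 : ℕ) : ℂ) / (2 * (1 : ℕ))) ^ 2 * (τ : ℂ) +
        2 * ((n : ℂ) + ((1 : ℕ) : ℂ) / (2 * (1 : ℕ))) * z)) := by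
  have h2τ : 0 < (2 * (τ : ℂ)).im := by simpa using τ.im_pos
  refine (((hasSum_jacobiTheta₂_term (2 * z + τ) h2τ).summable).mul_left
    (Complex.exp (π * Complex.I * τ / 2 + 2 * π * Complex.I * z))).congr fun n => ?_
  unfold jacobiTheta₂_term
  rw [← Complex.exp_add]
  congr 1
  push_cast
  ring

lemma theta_I_ne_zero {r : ℕ} (hs : Summable fun n : ℤ =>
      Complex.exp (2 * π * Complex.I * (1 : ℕ) *
        (((n : ℂ) + (r : ℂ) / (2 * (1 : ℕ))) ^ 2 * ((I : ℍ) : ℂ) +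
          2 * ((n : ℂ) + (r : ℂ) / (2 * (1 : ℕ))) * 0))) :
    theta 1 r I 0 ≠ 0 := by
  have hterm : ∀ n : ℤ, Complex.exp (2 * π * Complex.I * (1 : ℕ) *
        (((n : ℂ) + (r : ℂ) / (2 * (1 : ℕ))) ^ 2 * ((I : ℍ) : ℂ) +
          2 * ((n : ℂ) + (r : ℂ) / (2 * (1 : ℕ))) * 0)) =
      ((Real.exp (-(2 * π * ((n : ℝ) + (r : ℝ) / 2) ^ 2)) : ℝ) : ℂ) := by
    intro n
    rw [Complex.ofReal_exp]
    congr 1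
    push_cast
    linear_combination (2 * π * ((n : ℂ) + (r : ℂ) / 2) ^ 2) * Complex.I_sq
  unfold theta
  simp only [hterm] at hs ⊢
  rw [Complex.summable_ofReal] at hs
  rw [← Complex.ofReal_tsum]
  exact_mod_cast (hs.tsum_pos (fun n => (Real.exp_pos _).le) 0 (Real.exp_pos _)).ne'

lemma isThetaMultiplier_unique {γ : SL(2, ℤ)} {U V : Matrix (Fin 2) (Fin 2) ℂ}
    (hU : IsThetaMultiplier γ U) (hV : IsThetaMultiplier γ V) : U = V := by
  have hUV : ∀ τ z, U.mulVec (thetaVec τ z) = V.mulVec (thetaVec τ z) := by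
    intro τ z
    have h := (hU τ z).symm.trans (hV τ z)
    exact smul_right_injective _ (mul_ne_zero (Complex.exp_ne_zero _)
      (sqrt_ne_zero (autFactor_ne_zero γ τ))) h
  have h0 : theta 1 0 I 0 ≠ 0 := theta_I_ne_zero (hasSum_theta_zero I 0)
  have h1 : theta 1 1 I 0 ≠ 0 := theta_I_ne_zero (hasSum_theta_one I 0)
  have key : ∀ i : Fin 2, U i 0 = V i 0 ∧ U i 1 = V i 1 := by
    intro i
    have a := congrFun (hUV I 0) i
    have b := congrFun (hUV I (0 + 1 / 2)) i
    simp only [thetaVec, (theta_add' I 0).1, (theta_add' I 0).2] at a b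
    simp only [Matrix.mulVec, dotProduct, Fin.sum_univ_two, Matrix.cons_val_zero,
      Matrix.cons_val_one] at a b
    constructor
    · apply mul_right_cancel₀ h0
      linear_combination (a + b) / 2
    · apply mul_right_cancel₀ h1
      linear_combination (a - b) / 2
  ext i j
  fin_cases j
  · exact (key i).1
  · exact (key i).2

/-- The matrix `U₁(γ)` of the transformation of the theta vector `(θ^J_{1,0}, θ^J_{1,1})`. -/
def thetaMultiplier (γ : SL(2, ℤ)) : Matrix (Fin 2) (Fin 2) ℂ :=
  (exists_isThetaMultiplier γ).choose

lemma thetaMultiplier_spec (γ : SL(2, ℤ)) : IsThetaMultiplier γ (thetaMultiplier γ) :=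
  (exists_isThetaMultiplier γ).choose_spec

/-! ## Characters -/

/-- The character `γ ↦ det U₁(γ)` of `SL(2, ℤ)`. -/
def detThetaMultiplier : SL(2, ℤ) →* ℂ where
  toFun γ := (thetaMultiplier γ).det
  map_one' := by
    rw [isThetaMultiplier_unique (thetaMultiplier_spec 1) isThetaMultiplier_one, Matrix.det_one]
  map_mul' γ δ := by
    obtain ⟨ε, hε, h⟩ := isThetaMultiplier_mul (thetaMultiplier_spec γ) (thetaMultiplier_spec δ)
    rw [isThetaMultiplier_unique (thetaMultiplier_spec (γ * δ)) h, Matrix.det_smul,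
      Matrix.det_mul, Fintype.card_fin, hε, one_mul]

lemma dvd_of_mem_Gamma0 {m : ℕ} (γ : Gamma0 m) : (m : ℤ) ∣ (γ : SL(2, ℤ)) 1 0 := by
  have h := Gamma0_mem.mp γ.2
  rwa [ZMod.intCast_zmod_eq_zero_iff_dvd] at h

/-- The map `γ = (a, b; c, d) ↦ γ_m = (a, b m; c / m, d)` from `Γ₀(m)` to `SL(2, ℤ)`. -/
def conjGamma0 (m : ℕ) (γ : Gamma0 m) : SL(2, ℤ) :=
  ⟨!![(γ : SL(2, ℤ)) 0 0, (γ : SL(2, ℤ)) 0 1 * m;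
      (γ : SL(2, ℤ)) 1 0 / m, (γ : SL(2, ℤ)) 1 1], by
    have hdet := Matrix.det_fin_two (γ : SL(2, ℤ)).1
    rw [(γ : SL(2, ℤ)).2] at hdet
    have h := Int.mul_ediv_cancel' (dvd_of_mem_Gamma0 γ)
    rw [Matrix.det_fin_two_of]
    linear_combination (-(γ : SL(2, ℤ)) 0 1) * h - hdet⟩

lemma conjGamma0_mul (m : ℕ) (γ δ : Gamma0 m) :
    conjGamma0 m (γ * δ) = conjGamma0 m γ * conjGamma0 m δ := by
  obtain ⟨x, hx⟩ := dvd_of_mem_Gamma0 γ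
  obtain ⟨y, hy⟩ := dvd_of_mem_Gamma0 δ
  have hxy : (γ * δ : Gamma0 m).1 1 0 = m * (x * (δ : SL(2, ℤ)) 0 0 + (γ : SL(2, ℤ)) 1 1 * y) := by
    simp only [Subgroup.coe_mul, Matrix.SpecialLinearGroup.coe_mul, Matrix.mul_apply,
      Fin.sum_univ_two]
    rw [hx, hy]
    ring
  ext i j
  rw [Matrix.SpecialLinearGroup.coe_mul]
  rcases eq_or_ne m 0 with rfl | hm
  · fin_cases i <;> fin_cases j <;>
      simp [conjGamma0, Matrix.mul_apply, Fin.sum_univ_two, hx, hy]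
  · have hm' : (m : ℤ) ≠ 0 := by exact_mod_cast hm
    simp only [conjGamma0, hxy, hx, hy, Int.mul_ediv_cancel_left _ hm']
    fin_cases i <;> fin_cases j <;>
      simp [Matrix.mul_apply, Fin.sum_univ_two, hx, hy] <;> ring

/-- The character `ω_m(γ) = det U₁(γ_m)` of `Γ₀(m)`. -/
def omega (m : ℕ) : Gamma0 m →* ℂ where
  toFun γ := detThetaMultiplier (conjGamma0 m γ)
  map_one' := by
    have : conjGamma0 m 1 = 1 := by
      ext i j
      fin_cases i <;> fin_cases j <;> simp [conjGamma0]
    rw [this, map_one]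
  map_mul' γ δ := by rw [conjGamma0_mul, map_mul]

lemma Gamma0_le_of_dvd {m M : ℕ} (h : m ∣ M) : Gamma0 M ≤ Gamma0 m := by
  intro γ hγ
  rw [Gamma0_mem, ZMod.intCast_zmod_eq_zero_iff_dvd] at *
  exact (Int.natCast_dvd_natCast.mpr h).trans hγ

/-- The restriction of a character of `Γ₀(m)` to the subgroup `Γ₀(M)`, for `m ∣ M`. -/
def restrictChar {m M : ℕ} (h : m ∣ M) (ν : Gamma0 m →* ℂ) : Gamma0 M →* ℂ :=
  ν.comp (Subgroup.inclusion (Gamma0_le_of_dvd h))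

/-- The complex conjugate of a character. -/
def conjChar {M : ℕ} (ν : Gamma0 M →* ℂ) : Gamma0 M →* ℂ :=
  ((starRingEnd ℂ : ℂ →+* ℂ) : ℂ →* ℂ).comp ν

/-- The character `(a, b; c, d) ↦ χ(d)` of `Γ₀(M)` given by a Dirichlet character `χ` modulo `M`. -/
def dirichletChar {M : ℕ} (χ : DirichletCharacter ℂ M) : Gamma0 M →* ℂ :=
  χ.toMonoidHom.comp (Gamma0Map M)

/-! ## Jacobi forms -/

/-- The weight `k`, index `m` action of `γ = (a, b; c, d)` on functions on `ℍ × ℂ`: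
`(c τ + d)^{-k} exp (-2 π i m c z² / (c τ + d)) φ((a τ + b) / (c τ + d), z / (c τ + d))`. -/
def jacobiSlash (k : ℤ) (m : ℕ) (γ : SL(2, ℤ)) (φ : ℍ → ℂ → ℂ) (τ : ℍ) (z : ℂ) : ℂ :=
  autFactor γ τ ^ (-k) *
    Complex.exp (-(2 * π * Complex.I * m * ((γ 1 0 : ℂ) * z ^ 2 / autFactor γ τ))) *
      φ (γ • τ) (z / autFactor γ τ)

/-- `φ` has an (absolutely convergent) Fourier expansion
`φ(τ, z) = ∑ c(n, r) exp (2 π i (n τ / h + r z))` over integers `n`, `r`, for some `h ≥ 1`,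
with `c(n, r) = 0` unless `r² ≤ 4 m (n / h)`. -/
def HasJacobiExpansion (m : ℕ) (φ : ℍ → ℂ → ℂ) : Prop :=
  ∃ (h : ℕ) (c : ℤ × ℤ → ℂ), 0 < h ∧
    (∀ n r : ℤ, c (n, r) ≠ 0 → (h : ℤ) * r ^ 2 ≤ 4 * m * n) ∧
    ∀ (τ : ℍ) (z : ℂ), HasSum (fun p : ℤ × ℤ =>
      c p * Complex.exp (2 * π * Complex.I * ((p.1 : ℂ) / h * τ + p.2 * z))) (φ τ z)

lemma HasJacobiExpansion.rescale {m h : ℕ} {φ : ℍ → ℂ → ℂ} {c : ℤ × ℤ → ℂ} (hh : 0 < h)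
    (hc : ∀ n r : ℤ, c (n, r) ≠ 0 → (h : ℤ) * r ^ 2 ≤ 4 * m * n)
    (hs : ∀ (τ : ℍ) (z : ℂ), HasSum (fun p : ℤ × ℤ =>
      c p * Complex.exp (2 * π * Complex.I * ((p.1 : ℂ) / h * τ + p.2 * z))) (φ τ z))
    (l : ℕ) (hl : 0 < l) :
    ∃ c' : ℤ × ℤ → ℂ,
      (∀ n r : ℤ, c' (n, r) ≠ 0 → ((h * l : ℕ) : ℤ) * r ^ 2 ≤ 4 * m * n) ∧
      ∀ (τ : ℍ) (z : ℂ), HasSum (fun p : ℤ × ℤ =>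
        c' p * Complex.exp (2 * π * Complex.I * ((p.1 : ℂ) / (h * l : ℕ) * τ + p.2 * z)))
          (φ τ z) := by
  classical
  have hl' : (l : ℤ) ≠ 0 := by exact_mod_cast hl.ne'
  refine ⟨fun p => if (l : ℤ) ∣ p.1 then c (p.1 / l, p.2) else 0, fun n r hn => ?_,
    fun τ z => ?_⟩
  · by_cases hd : (l : ℤ) ∣ n
    · simp only [hd, if_true] at hn
      obtain ⟨n', rfl⟩ := hd
      rw [Int.mul_ediv_cancel_left _ hl'] at hn
      have := mul_le_mul_of_nonneg_left (hc _ _ hn) (Int.natCast_nonneg l)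
      push_cast
      linarith
    · simp [hd] at hn
  · have hi : Function.Injective fun p : ℤ × ℤ => ((l : ℤ) * p.1, p.2) := by
      rintro ⟨a, b⟩ ⟨a', b'⟩ hab
      simpa [hl', hl.ne'] using hab
    rw [← hi.hasSum_iff]
    · refine (hs τ z).congr_fun fun p => ?_
      have h1 : (l : ℂ) ≠ 0 := by exact_mod_cast hl.ne'
      have h2 : (h : ℂ) ≠ 0 := by exact_mod_cast hh.ne'
      simp only [Function.comp_apply, dvd_mul_right, if_true, Int.mul_ediv_cancel_left _ hl']
      congr 4
      push_cast
      field_simp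
    · rintro ⟨n, r⟩ hp
      have : ¬ (l : ℤ) ∣ n := by
        rintro ⟨n', rfl⟩
        exact hp ⟨(n', r), rfl⟩
      simp [this]

lemma HasJacobiExpansion.add {m : ℕ} {φ ψ : ℍ → ℂ → ℂ} (hφ : HasJacobiExpansion m φ)
    (hψ : HasJacobiExpansion m ψ) : HasJacobiExpansion m (φ + ψ) := by
  obtain ⟨h, c, hh, hc, hs⟩ := hφ
  obtain ⟨l, d, hl, hd, ht⟩ := hψ
  obtain ⟨c', hc', hs'⟩ := HasJacobiExpansion.rescale hh hc hs l hl
  obtain ⟨d', hd', ht'⟩ := HasJacobiExpansion.rescale hl hd ht h hh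
  rw [mul_comm l h] at hd' ht'
  refine ⟨h * l, c' + d', Nat.mul_pos hh hl, fun n r hn => ?_, fun τ z => ?_⟩
  · by_cases h0 : c' (n, r) = 0
    · refine hd' n r fun h1 => hn ?_
      simp [h0, h1]
    · exact hc' n r h0
  · refine ((hs' τ z).add (ht' τ z)).congr_fun fun p => ?_
    simp only [Pi.add_apply]
    ring

lemma HasJacobiExpansion.smul {m : ℕ} {φ : ℍ → ℂ → ℂ} (a : ℂ) (hφ : HasJacobiExpansion m φ) :
    HasJacobiExpansion m (a • φ) := by
  obtain ⟨h, c, hh, hc, hs⟩ := hφ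
  refine ⟨h, a • c, hh, fun n r hn => hc n r fun h0 => hn (by simp [h0]), fun τ z => ?_⟩
  refine ((hs τ z).mul_left a).congr_fun fun p => ?_
  simp only [Pi.smul_apply, smul_eq_mul]
  ring

lemma jacobiSlash_add (k : ℤ) (m : ℕ) (γ : SL(2, ℤ)) (φ ψ : ℍ → ℂ → ℂ) :
    jacobiSlash k m γ (φ + ψ) = jacobiSlash k m γ φ + jacobiSlash k m γ ψ := by
  ext τ z
  simp only [jacobiSlash, Pi.add_apply]
  ring

lemma jacobiSlash_smul (k : ℤ) (m : ℕ) (γ : SL(2, ℤ)) (a : ℂ) (φ : ℍ → ℂ → ℂ) :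
    jacobiSlash k m γ (a • φ) = a • jacobiSlash k m γ φ := by
  ext τ z
  simp only [jacobiSlash, Pi.smul_apply, smul_eq_mul]
  ring

/-- The space `J_{k,m}(Γ₀(M), ν)` of Jacobi forms of weight `k`, index `m` and character `ν` for
the Jacobi group `Γ₀(M) ⋉ ℤ²`: holomorphic functions on `ℍ × ℂ` with the transformation behaviour
under `Γ₀(M)` and under `ℤ²`, and holomorphic at all cusps. -/
def jacobiForms (k : ℤ) (m M : ℕ) (ν : Gamma0 M →* ℂ) : Submodule ℂ (ℍ → ℂ → ℂ) where
  carrier := {φ |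
    DifferentiableOn ℂ (fun p : ℂ × ℂ => φ (ofComplex p.1) p.2) {p | 0 < p.1.im} ∧
    (∀ γ : Gamma0 M, jacobiSlash k m γ φ = ν γ • φ) ∧
    (∀ (l u : ℤ) (τ : ℍ) (z : ℂ), φ τ (z + l * τ + u) =
      Complex.exp (-(2 * π * Complex.I * m * ((l : ℂ) ^ 2 * τ + 2 * l * z))) * φ τ z) ∧
    (∀ g : SL(2, ℤ), HasJacobiExpansion m (jacobiSlash k m g φ))}
  zero_mem' := by
    refine ⟨by simp, fun γ => ?_, fun l u τ z => by simp, fun g => ⟨1, 0, one_pos, ?_, ?_⟩⟩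
    · ext τ z; simp [jacobiSlash]
    · intro n r h; simp at h
    · intro τ z
      simp [jacobiSlash]
  add_mem' := by
    rintro φ ψ ⟨a1, a2, a3, a4⟩ ⟨b1, b2, b3, b4⟩
    refine ⟨a1.add b1, fun γ => ?_, fun l u τ z => ?_, fun g => ?_⟩
    · rw [jacobiSlash_add, a2, b2, smul_add]
    · simp only [Pi.add_apply, a3, b3, mul_add]
    · rw [jacobiSlash_add]; exact (a4 g).add (b4 g)
  smul_mem' := by
    rintro a φ ⟨a1, a2, a3, a4⟩
    refine ⟨a1.const_smul a, fun γ => ?_, fun l u τ z => ?_, fun g => ?_⟩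
    · rw [jacobiSlash_smul, a2, smul_comm]
    · simp only [Pi.smul_apply, a3, smul_eq_mul]; ring
    · rw [jacobiSlash_smul]; exact (a4 g).smul a

/-- The restriction map `D₀ : φ ↦ φ(τ, 0)`. -/
def restrictionMap : (ℍ → ℂ → ℂ) →ₗ[ℂ] (ℍ → ℂ) where
  toFun φ τ := φ τ 0
  map_add' _ _ := rfl
  map_smul' _ _ := rfl

/-- `J_{k,m}(Γ₀(M), ν)^0`, the kernel of the restriction map on `J_{k,m}(Γ₀(M), ν)`. -/
def jacobiKernel (k : ℤ) (m M : ℕ) (ν : Gamma0 M →* ℂ) : Submodule ℂ (ℍ → ℂ → ℂ) :=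
  jacobiForms k m M ν ⊓ LinearMap.ker restrictionMap

/-- `(h_r)_{0 ≤ r < 2m}` are the coefficients of the theta decomposition
`φ(τ, z) = ∑_{r=0}^{2m-1} h_r(τ) θ^J_{m,r}(τ, z)`. They are determined by `φ`. -/
def IsThetaDecomposition (m : ℕ) (φ : ℍ → ℂ → ℂ) (h : ℕ → ℍ → ℂ) : Prop :=
  ∀ (τ : ℍ) (z : ℂ), φ τ z = ∑ r ∈ Finset.range (2 * m), h r τ * theta m r τ z

/-- `J*_{k,m}(Γ₀(M), ν)`: the Jacobi forms whose theta decomposition has `h_r = 0` for all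
`r ≠ 0, m`. -/
def jacobiStar (k : ℤ) (m M : ℕ) (ν : Gamma0 M →* ℂ) : Submodule ℂ (ℍ → ℂ → ℂ) where
  carrier := {φ | φ ∈ jacobiForms k m M ν ∧ ∃ h : ℕ → ℍ → ℂ, IsThetaDecomposition m φ h ∧
    ∀ r < 2 * m, r ≠ 0 → r ≠ m → h r = 0}
  zero_mem' := ⟨zero_mem _, 0, fun τ z => by simp, fun _ _ _ _ => rfl⟩
  add_mem' := by
    rintro φ ψ ⟨a1, h, a2, a3⟩ ⟨b1, l, b2, b3⟩
    refine ⟨add_mem a1 b1, h + l, fun τ z => ?_, fun r h1 h2 h3 => ?_⟩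
    · simp only [Pi.add_apply, a2 τ z, b2 τ z, add_mul, Finset.sum_add_distrib]
    · rw [Pi.add_apply, a3 r h1 h2 h3, b3 r h1 h2 h3, add_zero]
  smul_mem' := by
    rintro a φ ⟨a1, h, a2, a3⟩
    refine ⟨Submodule.smul_mem _ a a1, a • h, fun τ z => ?_, fun r h1 h2 h3 => ?_⟩
    · simp only [Pi.smul_apply, smul_eq_mul, a2 τ z, Finset.mul_sum, mul_assoc]
    · rw [Pi.smul_apply, a3 r h1 h2 h3, smul_zero]

/-- `J*_{k,m}(Γ₀(M), ν)^0`, the kernel of the restriction map on `J*_{k,m}(Γ₀(M), ν)`. -/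
def jacobiStarKernel (k : ℤ) (m M : ℕ) (ν : Gamma0 M →* ℂ) : Submodule ℂ (ℍ → ℂ → ℂ) :=
  jacobiStar k m M ν ⊓ LinearMap.ker restrictionMap

/-! ## Modular forms with character -/

/-- The space `M_k(Γ₀(M), ν)` of modular forms of weight `k` and character `ν` for `Γ₀(M)`:
holomorphic functions `f` on `ℍ` with `f(γ τ) = ν(γ) (c τ + d)^k f(τ)` for `γ ∈ Γ₀(M)` which are
holomorphic at all cusps. -/
def modularForms (k : ℤ) (M : ℕ) (ν : Gamma0 M →* ℂ) : Submodule ℂ (ℍ → ℂ) where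
  carrier := {f | MDiff f ∧
    (∀ (γ : Gamma0 M) (τ : ℍ),
      f ((γ : SL(2, ℤ)) • τ) = ν γ * autFactor γ τ ^ k * f τ) ∧
    ∀ g : SL(2, ℤ), IsBoundedAtImInfty (f ∣[k] g)}
  zero_mem' := ⟨mdifferentiable_const, fun γ τ => by simp, fun g => by
    rw [SlashAction.zero_slash]; exact zero_form_isBoundedAtImInfty⟩
  add_mem' := by
    rintro f f' ⟨a1, a2, a3⟩ ⟨b1, b2, b3⟩
    refine ⟨a1.add b1, fun γ τ => ?_, fun g => ?_⟩
    · simp only [Pi.add_apply, a2, b2, mul_add]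
    · rw [SlashAction.add_slash]; exact (a3 g).add (b3 g)
  smul_mem' := by
    rintro a f ⟨a1, a2, a3⟩
    refine ⟨a1.const_smul a, fun γ τ => ?_, fun g => ?_⟩
    · simp only [Pi.smul_apply, a2, smul_eq_mul]; ring
    · rw [ModularForm.SL_smul_slash]; exact (a3 g).const_smul_left a

end

end JacobiRestriction

open JacobiRestriction

/-!
Up to a factor depending on `τ` only, the combination of `θ_{m,0}` and `θ_{m,m}` which vanishes at
`z = 0` is `Θ_m(τ, z) = θ_{m,m}(τ, 0) θ_{m,0}(τ, z) - θ_{m,0}(τ, 0) θ_{m,m}(τ, z)`. The two theta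
nulls have no common zero, so every element of `J*_{k,m}(Γ₀(M), ν ω_m)^0` is `f Θ_m` for a unique
function `f` of `τ`, which is holomorphic because no `Θ_m(τ, ·)` vanishes identically.
Since `Θ_1` is a determinant of index one theta vectors, it transforms with weight `1` and
character `det U₁`; as `Θ_m(τ, z) = Θ_1(mτ, mz)`, the form `Θ_m` has weight `1`, index `m` and
character `ω_m` on `Γ₀(m)`. At an arbitrary cusp `g`, the Hermite decomposition
`diag(m, 1) g = g' (a, b; 0, d)` makes `Θ_m | g` a multiple of `Θ_1((aτ + b) / d, a z)`. The Fourier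
coefficient of index `a` of the latter in `z` is of exact order `e(a τ / 4d)`, and `n = a / 4d`,
`r = a` satisfy `r² = 4mn` because `a d = m`: the condition `r² ≤ 4mn` on the Fourier expansion of
`(f Θ_m) | g` says precisely that `f | g` is bounded at infinity. Thus `f ↦ f Θ_m` identifies
`M_{k-1}(Γ₀(M), ν)` with `J*_{k,m}(Γ₀(M), ν ω_m)^0`. Take `ν = χ ω̄`, with index `m` and with
index `1`, where `J*_{k,1} = J_{k,1}` and `ω̄ ω = 1`.
-/

namespace JacobiRestriction

noncomputable section

local notation "𝐞(" x ")" => Complex.exp (2 * π * Complex.I * x)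

/-- Holomorphy of a function on `ℍ × ℂ`, in the form used in the definition of `jacobiForms`. -/
abbrev IsHolomorphic (φ : ℍ → ℂ → ℂ) : Prop :=
  DifferentiableOn ℂ (fun p : ℂ × ℂ => φ (ofComplex p.1) p.2) {p | 0 < p.1.im}

/-- The coefficient of `e(p² / (4m) τ + p z)` in the Fourier expansion of `θ^J_{m,r}`. -/
def thetaCoeff (m r : ℕ) (p : ℤ) : ℂ := if p ≡ r [ZMOD 2 * m] then 1 else 0

section Theta

variable {m : ℕ} (hm : 0 < m) (r : ℕ) (τ : ℍ) (z : ℂ)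

include hm

lemma two_mul_im_pos : 0 < (2 * m * (τ : ℂ)).im := by
  have := τ.im_pos
  simpa [hm] using this

lemma exp_mul_jacobiTheta₂_term (n : ℤ) :
    𝐞((r : ℂ) ^ 2 / (4 * m) * τ + r * z) * jacobiTheta₂_term n (r * τ + 2 * m * z) (2 * m * τ) =
      𝐞(m * (((n : ℂ) + r / (2 * m)) ^ 2 * τ + 2 * ((n : ℂ) + r / (2 * m)) * z)) := by
  have hm' : (m : ℂ) ≠ 0 := by exact_mod_cast hm.ne'
  rw [jacobiTheta₂_term, ← Complex.exp_add]
  congr 1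
  field_simp
  ring

lemma theta_eq_jacobiTheta₂ : theta m r τ z =
    𝐞((r : ℂ) ^ 2 / (4 * m) * τ + r * z) * jacobiTheta₂ (r * τ + 2 * m * z) (2 * m * τ) := by
  rw [jacobiTheta₂, ← tsum_mul_left, theta]
  exact tsum_congr fun n => by rw [exp_mul_jacobiTheta₂_term hm, mul_assoc _ (m : ℂ)]

lemma hasSum_theta : HasSum
    (fun p : ℤ => thetaCoeff m r p * 𝐞((p : ℂ) ^ 2 / (4 * m) * τ + p * z)) (theta m r τ z) := by
  have hm' : (m : ℂ) ≠ 0 := by exact_mod_cast hm.ne'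
  have hinj : Function.Injective fun n : ℤ => 2 * m * n + r := fun a b h => by
    simpa [hm.ne'] using h
  have hterms := (hasSum_jacobiTheta₂_term (r * τ + 2 * m * z) (two_mul_im_pos hm τ)).mul_left
    𝐞((r : ℂ) ^ 2 / (4 * m) * τ + r * z)
  rw [← theta_eq_jacobiTheta₂ hm] at hterms
  rw [← hinj.hasSum_iff fun p hp => ?_]
  · refine hterms.congr_fun fun n => ?_
    have hmod : 2 * m * n + r ≡ r [ZMOD 2 * m] := by simp [Int.modEq_iff_dvd]
    rw [exp_mul_jacobiTheta₂_term hm, Function.comp_apply, thetaCoeff, if_pos hmod, one_mul]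
    congr 1
    push_cast
    field_simp
    ring
  · rw [thetaCoeff, if_neg, zero_mul]
    intro hmod
    obtain ⟨n, hn⟩ := hmod.symm.dvd
    exact hp ⟨n, by linarith⟩

lemma theta_elliptic (l u : ℤ) : theta m r τ (z + l * τ + u) =
    Complex.exp (-(2 * π * Complex.I * m * ((l : ℂ) ^ 2 * τ + 2 * l * z))) * theta m r τ z := by
  have hm' : (m : ℂ) ≠ 0 := by exact_mod_cast hm.ne'
  unfold theta
  rw [← tsum_mul_left, ← (Equiv.addRight l).tsum_eq (fun n : ℤ =>
    Complex.exp (-(2 * π * Complex.I * m * ((l : ℂ) ^ 2 * τ + 2 * l * z))) * Complex.exp _)]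
  refine tsum_congr fun n => ?_
  have hper : 𝐞(((2 * m * n + r) * u : ℤ)) = 1 := by
    rw [Complex.exp_eq_one_iff]; exact ⟨_, by ring⟩
  rw [← Complex.exp_add, Equiv.coe_addRight, ← mul_one (Complex.exp (_ + _)), ← hper,
    ← Complex.exp_add]
  congr 1
  push_cast
  field_simp
  ring

omit τ z

lemma isHolomorphic_theta : IsHolomorphic (theta m r) := by
  rintro ⟨t, z⟩ (ht : 0 < t.im)
  refine DifferentiableAt.differentiableWithinAt ?_
  have ht' : 0 < (2 * m * t).im := two_mul_im_pos hm ⟨t, ht⟩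
  have hθ := (hasFDerivAt_jacobiTheta₂ (r * t + 2 * m * z) ht').differentiableAt.comp (t, z)
    (f := fun p : ℂ × ℂ => (r * p.1 + 2 * m * p.2, 2 * m * p.1)) (by fun_prop)
  have hexp : DifferentiableAt ℂ
      (fun p : ℂ × ℂ => 𝐞((r : ℂ) ^ 2 / (4 * m) * p.1 + r * p.2)) (t, z) := by fun_prop
  refine (hexp.mul hθ).congr_of_eventuallyEq ?_
  have hev : ∀ᶠ p : ℂ × ℂ in nhds (t, z), 0 < p.1.im :=
    (Complex.continuous_im.comp continuous_fst).continuousAt.eventually_const_lt ht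
  filter_upwards [hev] with p hp
  rw [theta_eq_jacobiTheta₂ hm, ofComplex_apply_of_im_pos hp]
  rfl

end Theta

/-- The point `(a τ + b) / d` of the upper half-plane; a junk value if `a = 0` or `d = 0`. -/
def affineMap (a d : ℕ) (b : ℤ) (τ : ℍ) : ℍ := ofComplex ((a * τ + b) / d)

lemma coe_affineMap {a d : ℕ} (ha : 0 < a) (hd : 0 < d) (b : ℤ) (τ : ℍ) :
    (affineMap a d b τ : ℂ) = (a * τ + b) / d := by
  have h : 0 < (((a : ℂ) * τ + b) / d).im := by
    have := τ.im_pos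
    simp only [Complex.div_natCast_im, Complex.add_im, Complex.mul_im, Complex.natCast_re,
      Complex.natCast_im, Complex.intCast_im, coe_im, zero_mul, add_zero]
    positivity
  rw [affineMap, ofComplex_apply_of_im_pos h]

/-- The Hermite normal form `diag(m, 1) g = g' (a, b; 0, d)` of the matrix `diag(m, 1) g`, with
`g' ∈ SL(2, ℤ)`; the divisibility condition `0 ≤ b < d` is not imposed. -/
structure IsHermiteDecomposition (m : ℕ) (g g' : SL(2, ℤ)) (a d : ℕ) (b : ℤ) : Prop where
  pos_left : 0 < a
  pos_right : 0 < d
  eq : !![(m : ℤ), 0; 0, 1] * (g : Matrix (Fin 2) (Fin 2) ℤ) =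
    (g' : Matrix (Fin 2) (Fin 2) ℤ) * !![(a : ℤ), b; 0, (d : ℤ)]

lemma exists_eq_mul_upperTriangular {m : ℕ} (hm : 0 < m)
    (A : FixedDetMatrix (Fin 2) ℤ m) :
    ∃ (g : SL(2, ℤ)) (a d : ℕ) (b : ℤ), 0 < a ∧ 0 < d ∧
      A.1 = (g : Matrix (Fin 2) (Fin 2) ℤ) * !![(a : ℤ), b; 0, (d : ℤ)] := by
  induction A using FixedDetMatrices.induction_on (Int.natCast_ne_zero.mpr hm.ne') with
  | h0 A h10 h00 _ _ =>
    have hdet : A.1 0 0 * A.1 1 1 = m := by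
      have := A.2
      rwa [Matrix.det_fin_two, h10, mul_zero, sub_zero] at this
    have h11 : 0 < A.1 1 1 :=
      pos_of_mul_pos_right (hdet.symm ▸ Int.natCast_pos.mpr hm) h00.le
    lift A.1 0 0 to ℕ using h00.le with a ha
    lift A.1 1 1 to ℕ using h11.le with d hd
    refine ⟨1, a, d, A.1 0 1, mod_cast h00, mod_cast h11, ?_⟩
    rw [ha, hd, ← h10, Matrix.SpecialLinearGroup.coe_one, one_mul]
    exact Matrix.eta_fin_two A.1
  | hS B ih =>
    obtain ⟨g, a, d, b, ha, hd, h⟩ := ih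
    exact ⟨ModularGroup.S * g, a, d, b, ha, hd, by
      rw [FixedDetMatrices.smul_coe, h, Matrix.SpecialLinearGroup.coe_mul, mul_assoc]⟩
  | hT B ih =>
    obtain ⟨g, a, d, b, ha, hd, h⟩ := ih
    exact ⟨ModularGroup.T * g, a, d, b, ha, hd, by
      rw [FixedDetMatrices.smul_coe, h, Matrix.SpecialLinearGroup.coe_mul, mul_assoc]⟩

lemma exists_isHermiteDecomposition {m : ℕ} (hm : 0 < m) (g : SL(2, ℤ)) :
    ∃ g' a d b, IsHermiteDecomposition m g g' a d b := by
  obtain ⟨g', a, d, b, ha, hd, h⟩ := exists_eq_mul_upperTriangular hm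
    ⟨!![(m : ℤ), 0; 0, 1] * g, by
      rw [Matrix.det_mul, Matrix.det_fin_two_of, Matrix.SpecialLinearGroup.det_coe]; ring⟩
  exact ⟨g', a, d, b, ha, hd, h⟩

lemma isHermiteDecomposition_conjGamma0 {m : ℕ} (hm : 0 < m) (γ : Gamma0 m) :
    IsHermiteDecomposition m γ (conjGamma0 m γ) m 1 0 := by
  refine ⟨hm, one_pos, ?_⟩
  have h : (γ : SL(2, ℤ)) 1 0 / m * m = (γ : SL(2, ℤ)) 1 0 :=
    Int.ediv_mul_cancel (dvd_of_mem_Gamma0 γ)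
  ext i j
  fin_cases i <;> fin_cases j <;> simp [conjGamma0, Matrix.mul_apply, h, mul_comm]

namespace IsHermiteDecomposition

variable {m : ℕ} {g g' : SL(2, ℤ)} {a d : ℕ} {b : ℤ} (h : IsHermiteDecomposition m g g' a d b)
  (τ : ℍ)

include h

omit τ in
lemma mul_eq : a * d = m := by
  have := congrArg Matrix.det h.eq
  simp only [Matrix.det_mul, Matrix.SpecialLinearGroup.det_coe, Matrix.det_fin_two_of] at this
  exact_mod_cast (by linarith : (a * d : ℤ) = m)

omit τ in
lemma entries : (m * g 0 0 = g' 0 0 * a ∧ m * g 0 1 = g' 0 0 * b + g' 0 1 * d) ∧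
    g 1 0 = g' 1 0 * a ∧ g 1 1 = g' 1 0 * b + g' 1 1 * d := by
  have := h.eq
  rw [Matrix.eta_fin_two (g : Matrix (Fin 2) (Fin 2) ℤ),
    Matrix.eta_fin_two (g' : Matrix (Fin 2) (Fin 2) ℤ)] at this
  simpa [← Matrix.ext_iff, Fin.forall_fin_two] using this

lemma autFactor_eq : autFactor g τ = d * autFactor g' (affineMap a d b τ) := by
  have hd : (d : ℂ) ≠ 0 := by exact_mod_cast h.pos_right.ne'
  obtain ⟨-, h10, h11⟩ := h.entries
  rw [autFactor, autFactor, coe_affineMap h.pos_left h.pos_right, h10, h11]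
  push_cast
  field_simp
  ring

lemma affineMap_smul : affineMap m 1 0 (g • τ) = g' • affineMap a d b τ := by
  have hd : (d : ℂ) ≠ 0 := by exact_mod_cast h.pos_right.ne'
  have hm : 0 < m := h.mul_eq ▸ Nat.mul_pos h.pos_left h.pos_right
  obtain ⟨⟨h00, h01⟩, -⟩ := h.entries
  have c00 : (m * g 0 0 : ℂ) = g' 0 0 * a := by exact_mod_cast h00
  have c01 : (m * g 0 1 : ℂ) = g' 0 0 * b + g' 0 1 * d := by exact_mod_cast h01
  have hg := coe_smul_mul_autFactor g τ
  have hg' := coe_smul_mul_autFactor g' (affineMap a d b τ)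
  rw [coe_affineMap h.pos_left h.pos_right] at hg'
  ext
  apply mul_right_cancel₀ (autFactor_ne_zero g τ)
  calc (affineMap m 1 0 (g • τ) : ℂ) * autFactor g τ = m * (g 0 0 * τ + g 0 1) := by
        rw [coe_affineMap hm one_pos, ← hg]; push_cast; ring
    _ = d * (g' 0 0 * ((a * τ + b) / d) + g' 0 1) := by
        field_simp; linear_combination τ * c00 + c01
    _ = ((g' • affineMap a d b τ : ℍ) : ℂ) * autFactor g τ := by
        rw [← hg', h.autFactor_eq]; ring

end IsHermiteDecomposition

lemma theta_mul_eq {m : ℕ} (hm : 0 < m) (r : ℕ) (τ : ℍ) (z : ℂ) :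
    theta m (m * r) τ z = theta 1 r (affineMap m 1 0 τ) (m * z) := by
  have hm' : (m : ℂ) ≠ 0 := by exact_mod_cast hm.ne'
  unfold theta
  rw [coe_affineMap hm one_pos]
  refine tsum_congr fun n => ?_
  congr 1
  push_cast
  field_simp
  ring

lemma theta_one_eq_theta_zero (τ : ℍ) (z : ℂ) :
    theta 1 1 τ z = 𝐞((τ : ℂ) / 4 + z) * theta 1 0 τ (z + τ / 2) := by
  rw [theta_one_eq, theta_zero_eq]
  congr 2 <;> ring

lemma half_lt_norm_theta_zero {τ : ℍ} (hτ : 1 / 2 ≤ τ.im) : 1 / 2 < ‖theta 1 0 τ 0‖ := by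
  have hbound := norm_jacobiTheta_sub_one_le (τ := 2 * τ) (by simpa using τ.im_pos)
  rw [jacobiTheta_eq_jacobiTheta₂, ← mul_zero 2, ← theta_zero_eq, neg_mul, Real.exp_neg] at hbound
  have hexp : 5 < Real.exp (π * (2 * (τ : ℂ)).im) := by
    have him : π ≤ π * (2 * (τ : ℂ)).im := by
      simp only [Complex.mul_im, Complex.re_ofNat, Complex.im_ofNat, zero_mul, add_zero, coe_im]
      nlinarith [Real.pi_pos]
    have := Real.quadratic_le_exp_of_nonneg (Real.pi_pos.le.trans him)
    nlinarith [Real.pi_gt_three]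
  have hinv : (Real.exp (π * (2 * (τ : ℂ)).im))⁻¹ < 1 / 5 := by
    rw [inv_lt_comm₀ (by positivity) (by norm_num)]
    simpa using hexp
  have hlt : ‖theta 1 0 τ 0 - 1‖ < 1 / 2 := by
    refine hbound.trans_lt ?_
    rw [div_mul_eq_mul_div, div_lt_iff₀ (by linarith)]
    linarith
  have htri := norm_sub_norm_le (1 : ℂ) (1 - theta 1 0 τ 0)
  rw [sub_sub_cancel, norm_one, norm_sub_rev] at htri
  linarith

lemma thetaVec_apply_zero_ne_zero (τ : ℍ) : thetaVec τ 0 ≠ 0 := by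
  intro h
  obtain ⟨γ, hγ⟩ := ModularGroup.exists_smul_mem_fd τ
  have him : 1 / 2 ≤ (γ • τ).im := by
    nlinarith [ModularGroup.three_le_four_mul_im_sq_of_mem_fd hγ, (γ • τ).im_pos]
  have hvec := thetaMultiplier_spec γ τ 0
  rw [h, Matrix.mulVec_zero, smul_zero, zero_div] at hvec
  have hzero : theta 1 0 (γ • τ) 0 = 0 := congrFun hvec 0
  have := half_lt_norm_theta_zero him
  rw [hzero, norm_zero] at this
  linarith

lemma theta_self_ne_zero_or_theta_zero_ne_zero {m : ℕ} (hm : 0 < m) (τ : ℍ) :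
    theta m m τ 0 ≠ 0 ∨ theta m 0 τ 0 ≠ 0 := by
  by_contra! h
  have h0 := theta_mul_eq hm 0 τ 0
  have h1 := theta_mul_eq hm 1 τ 0
  rw [mul_zero, mul_zero, h.2] at h0
  rw [mul_one, mul_zero, h.1] at h1
  exact thetaVec_apply_zero_ne_zero (affineMap m 1 0 τ) (by simp [thetaVec, ← h0, ← h1])

/-- The determinant of the theta functions `θ^J_{m,0}`, `θ^J_{m,m}` and of their values at `z = 0`.
Up to a factor depending on `τ` only, it is the one combination of these two theta functions
which vanishes at `z = 0`. -/
def thetaDet (m : ℕ) (τ : ℍ) (z : ℂ) : ℂ :=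
  theta m m τ 0 * theta m 0 τ z - theta m 0 τ 0 * theta m m τ z

lemma thetaDet_apply_zero (m : ℕ) (τ : ℍ) : thetaDet m τ 0 = 0 := by
  rw [thetaDet, mul_comm, sub_self]

lemma thetaDet_elliptic {m : ℕ} (hm : 0 < m) (τ : ℍ) (z : ℂ) (l u : ℤ) :
    thetaDet m τ (z + l * τ + u) =
      Complex.exp (-(2 * π * Complex.I * m * ((l : ℂ) ^ 2 * τ + 2 * l * z))) *
        thetaDet m τ z := by
  rw [thetaDet, theta_elliptic hm, theta_elliptic hm, thetaDet]
  ring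

lemma isHolomorphic_thetaDet {m : ℕ} (hm : 0 < m) : IsHolomorphic (thetaDet m) := by
  have hnull (r : ℕ) :
      DifferentiableOn ℂ (fun p : ℂ × ℂ => theta m r (ofComplex p.1) 0) {p | 0 < p.1.im} :=
    (isHolomorphic_theta hm r).comp (f := fun p : ℂ × ℂ => (p.1, (0 : ℂ))) (by fun_prop)
      fun _ hp => hp
  exact ((hnull m).mul (isHolomorphic_theta hm 0)).sub
    ((hnull 0).mul (isHolomorphic_theta hm m))

lemma thetaDet_eq_thetaDet_one {m : ℕ} (hm : 0 < m) (τ : ℍ) (z : ℂ) :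
    thetaDet m τ z = thetaDet 1 (affineMap m 1 0 τ) (m * z) := by
  have h0 (w : ℂ) := theta_mul_eq hm 0 τ w
  have h1 (w : ℂ) := theta_mul_eq hm 1 τ w
  simp only [mul_zero, mul_one] at h0 h1
  rw [thetaDet, thetaDet, h0, h1, h0, h1, mul_zero]

lemma exists_thetaDet_one_ne_zero (τ : ℍ) : ∃ z, thetaDet 1 τ z ≠ 0 := by
  by_contra! hzero
  have hshift (z : ℂ) : theta 1 1 τ 0 * theta 1 0 τ z = 0 ∧ theta 1 0 τ 0 * theta 1 1 τ z = 0 := by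
    have h := hzero z
    have h' := hzero (z + 1 / 2)
    rw [thetaDet, (theta_add' τ z).1, (theta_add' τ z).2] at h'
    rw [thetaDet] at h
    exact ⟨by linear_combination (h + h') / 2, by linear_combination (h' - h) / 2⟩
  rcases theta_self_ne_zero_or_theta_zero_ne_zero one_pos τ with h | h
  · have h0 : theta 1 0 τ (τ / 2) = 0 := (mul_eq_zero.mp (hshift _).1).resolve_left h
    rw [theta_one_eq_theta_zero, zero_add, h0, mul_zero] at h
    exact h rfl
  · have h1 : theta 1 1 τ (-(τ / 2)) = 0 := (mul_eq_zero.mp (hshift _).2).resolve_left h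
    rw [theta_one_eq_theta_zero, neg_add_cancel] at h1
    exact h ((mul_eq_zero.mp h1).resolve_left (Complex.exp_ne_zero _))

lemma exists_thetaDet_ne_zero {m : ℕ} (hm : 0 < m) (τ : ℍ) : ∃ z, thetaDet m τ z ≠ 0 := by
  obtain ⟨z, hz⟩ := exists_thetaDet_one_ne_zero (affineMap m 1 0 τ)
  have hm' : (m : ℂ) ≠ 0 := by exact_mod_cast hm.ne'
  exact ⟨z / m, by rwa [thetaDet_eq_thetaDet_one hm, mul_div_cancel₀ _ hm']⟩

lemma det_of_smul_mulVec {R : Type*} [CommRing R] (U : Matrix (Fin 2) (Fin 2) R) (s t : R)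
    (u v : Fin 2 → R) : (Matrix.of ![s • U.mulVec u, t • U.mulVec v]).det =
      s * t * U.det * (Matrix.of ![u, v]).det := by
  simp only [Matrix.det_fin_two, Matrix.of_apply, Matrix.cons_val_zero, Matrix.cons_val_one,
    Pi.smul_apply, smul_eq_mul, Matrix.mulVec, dotProduct, Fin.sum_univ_two]
  ring

lemma thetaDet_one_eq_det (τ : ℍ) (z : ℂ) :
    thetaDet 1 τ z = (Matrix.of ![thetaVec τ z, thetaVec τ 0]).det := by
  simp [thetaDet, thetaVec, Matrix.det_fin_two, mul_comm]

lemma thetaDet_one_smul (γ : SL(2, ℤ)) (τ : ℍ) (z : ℂ) :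
    thetaDet 1 (γ • τ) (z / autFactor γ τ) =
      𝐞((γ 1 0 : ℂ) * z ^ 2 / autFactor γ τ) * autFactor γ τ * detThetaMultiplier γ *
        thetaDet 1 τ z := by
  have h0 := thetaMultiplier_spec γ τ 0
  have hone : 𝐞((γ 1 0 : ℂ) * 0 ^ 2 / autFactor γ τ) = 1 := by simp
  rw [zero_div, hone, one_mul] at h0
  rw [thetaDet_one_eq_det, thetaMultiplier_spec γ τ z, h0, det_of_smul_mulVec,
    ← thetaDet_one_eq_det, mul_assoc _ (_ ^ _) (_ ^ _), ← sq, sqrt_sq]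
  rfl

lemma IsHermiteDecomposition.jacobiSlash_thetaDet {m : ℕ} {g g' : SL(2, ℤ)} {a d : ℕ} {b : ℤ}
    (h : IsHermiteDecomposition m g g' a d b) (τ : ℍ) (z : ℂ) :
    jacobiSlash 1 m g (thetaDet m) τ z =
      detThetaMultiplier g' / d * thetaDet 1 (affineMap a d b τ) (a * z) := by
  have hm : 0 < m := h.mul_eq ▸ Nat.mul_pos h.pos_left h.pos_right
  have hd : (d : ℂ) ≠ 0 := by exact_mod_cast h.pos_right.ne'
  have hmul : (m : ℂ) = a * d := by exact_mod_cast h.mul_eq.symm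
  have h10 : (g 1 0 : ℂ) = g' 1 0 * a := by exact_mod_cast h.entries.2.1
  have hj := autFactor_ne_zero g' (affineMap a d b τ)
  have hz : (m : ℂ) * (z / autFactor g τ) = a * z / autFactor g' (affineMap a d b τ) := by
    rw [h.autFactor_eq, hmul]
    field_simp
  have hexp : Complex.exp (-(2 * π * Complex.I * m * ((g 1 0 : ℂ) * z ^ 2 / autFactor g τ))) *
      𝐞((g' 1 0 : ℂ) * (a * z) ^ 2 / autFactor g' (affineMap a d b τ)) = 1 := by
    rw [← Complex.exp_add, h.autFactor_eq, hmul, h10, ← Complex.exp_zero]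
    congr 1
    field_simp
    ring
  rw [jacobiSlash, thetaDet_eq_thetaDet_one hm, h.affineMap_smul, hz, thetaDet_one_smul,
    zpow_neg_one, h.autFactor_eq]
  rw [h.autFactor_eq] at hexp
  generalize Complex.exp (-_) = x, Complex.exp (_ * (_ / _)) = y at hexp ⊢
  field_simp
  linear_combination detThetaMultiplier g' * thetaDet 1 (affineMap a d b τ) (a * z) * hexp

lemma jacobiSlash_thetaDet_Gamma0 {m : ℕ} (hm : 0 < m) (γ : Gamma0 m) (τ : ℍ) (z : ℂ) :
    jacobiSlash 1 m γ (thetaDet m) τ z = omega m γ * thetaDet m τ z := by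
  rw [(isHermiteDecomposition_conjGamma0 hm γ).jacobiSlash_thetaDet, Nat.cast_one, div_one,
    ← thetaDet_eq_thetaDet_one hm]
  rfl

section Fourier

variable {ι : Type*} [Countable ι] {c : ι → ℂ} {R : ι → ℤ}

lemma hasSum_fourierCoeff {T : ℝ} [Fact (0 < T)] {f : AddCircle T → ℂ}
    (hf : ∀ x, HasSum (fun i => c i * fourier (R i) x) (f x)) (s : ℤ) :
    HasSum (fun i => if R i = s then c i else 0) (fourierCoeff f s) := by
  have hc : Summable c := by simpa only [fourier_eval_zero, mul_one] using (hf 0).summable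
  have hnorm (i : ι) (x : AddCircle T) : ‖fourier (-s) x • (c i * fourier (R i) x)‖ = ‖c i‖ := by
    simp only [norm_smul, norm_mul, fourier_apply, Circle.norm_coe, one_mul, mul_one]
  have hint := MeasureTheory.hasSum_integral_of_summable_integral_norm
    (μ := (AddCircle.haarAddCircle : MeasureTheory.Measure (AddCircle T)))
    (F := fun i (x : AddCircle T) => fourier (-s) x • (c i * fourier (R i) x))
    (fun i => Continuous.integrable_of_hasCompactSupport (by fun_prop)
      (HasCompactSupport.of_compactSpace _))
    (by simpa only [hnorm, MeasureTheory.integral_const, MeasureTheory.probReal_univ, one_smul]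
      using hc.norm)
  simp only [((hf _).const_smul (fourier (-s) _)).tsum_eq] at hint
  refine hint.congr_fun fun i => ?_
  change _ = fourierCoeff (fun x => c i * fourier (R i) x) s
  rw [fourierCoeff.const_mul, fourierCoeff_fourier, Pi.single_apply, mul_ite, mul_one, mul_zero]
  exact if_congr eq_comm rfl rfl

lemma hasSum_fourierCoeffOn {f : ℂ → ℂ} (hf : ∀ z, HasSum (fun i => c i * 𝐞(R i * z)) (f z))
    (s : ℤ) : HasSum (fun i => if R i = s then c i else 0)
    (fourierCoeffOn zero_lt_one (fun x : ℝ => f x) s) := by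
  have : Fact ((0 : ℝ) < 1 - 0) := ⟨by norm_num⟩
  refine hasSum_fourierCoeff (fun y => ?_) s
  have hy : y ∈ ((↑) : ℝ → AddCircle ((1 : ℝ) - 0)) '' Set.Ioc 0 (0 + (1 - 0)) := by
    rw [AddCircle.coe_image_Ioc_eq]; trivial
  obtain ⟨x, hx, rfl⟩ := hy
  rw [AddCircle.liftIoc_coe_apply hx]
  refine (hf x).congr_fun fun i => ?_
  rw [fourier_coe_apply, sub_zero, Complex.ofReal_one, div_one, mul_assoc]

lemma fourierCoeffOn_eq {a : ℤ → ℂ} {f : ℂ → ℂ}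
    (hf : ∀ z, HasSum (fun r : ℤ => a r * 𝐞(r * z)) (f z)) (s : ℤ) :
    fourierCoeffOn zero_lt_one (fun x : ℝ => f x) s = a s :=
  (hasSum_fourierCoeffOn (R := id) hf s).unique <| (hasSum_ite_eq s (a s)).congr_fun fun r => by
    split_ifs with h <;> simp_all

end Fourier

section ThetaDecomposition

variable {m : ℕ} {a : ℤ → ℂ} {f : ℂ → ℂ}

lemma coeff_add_two_mul {τ : ℂ} (hs : ∀ z, HasSum (fun r : ℤ => a r * 𝐞(r * z)) (f z))
    (hf : ∀ z, f (z + τ) = 𝐞(-(m * (τ + 2 * z))) * f z) (r : ℤ) :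
    a (r + 2 * m) = 𝐞((r + m) * τ) * a r := by
  have hshift (z : ℂ) : HasSum (fun r : ℤ => a (r + 2 * m) * 𝐞(-(m * τ)) * 𝐞(r * z))
      (f (z + τ)) := by
    rw [hf]
    refine (((Equiv.addRight (2 * m : ℤ)).hasSum_iff.mpr (hs z)).mul_left _).congr_fun fun r => ?_
    simp only [Function.comp_apply, Equiv.coe_addRight]
    rw [mul_left_comm (Complex.exp _), mul_assoc (a _), ← Complex.exp_add, ← Complex.exp_add]
    congr 2
    push_cast
    ring
  have hterms (z : ℂ) : HasSum (fun r : ℤ => a r * 𝐞(r * τ) * 𝐞(r * z)) (f (z + τ)) :=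
    (hs (z + τ)).congr_fun fun r => by
      rw [mul_assoc, ← Complex.exp_add]
      congr 2
      ring
  have hcoeff : a (r + 2 * m) * 𝐞(-(m * τ)) = a r * 𝐞(r * τ) :=
    (fourierCoeffOn_eq (f := fun z => f (z + τ)) hshift r).symm.trans
      (fourierCoeffOn_eq (f := fun z => f (z + τ)) hterms r)
  have hinv : 𝐞(-(m * τ)) * 𝐞(m * τ) = 1 := by
    rw [← Complex.exp_add, ← mul_add, neg_add_cancel, mul_zero, Complex.exp_zero]
  rw [add_mul, mul_add, Complex.exp_add]
  linear_combination (-a (r + 2 * m)) * hinv + 𝐞(m * τ) * hcoeff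

lemma sum_mul_thetaCoeff (hm : 0 < m) {b : ℤ → ℂ} (hb : Function.Periodic b (2 * m)) (p : ℤ) :
    ∑ r ∈ Finset.range (2 * m), b r * thetaCoeff m r p = b p := by
  have hm' : (0 : ℤ) < 2 * m := by positivity
  obtain ⟨s, hs⟩ := Int.eq_ofNat_of_zero_le (Int.emod_nonneg p hm'.ne')
  have hlt : s < 2 * m := by
    have := Int.emod_lt_of_pos p hm'
    omega
  rw [Finset.sum_eq_single_of_mem s (Finset.mem_range.mpr hlt) fun r hr hrs => ?_]
  · rw [thetaCoeff, if_pos, mul_one, ← hs, Int.emod_def, mul_comm (2 * m : ℤ)]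
    · exact hb.sub_int_mul_eq (p / (2 * m))
    · rw [← hs]; exact (Int.mod_modEq _ _).symm
  · rw [thetaCoeff, if_neg, mul_zero]
    intro hmod
    have hr' : (r : ℤ) % (2 * m) = r :=
      Int.emod_eq_of_lt (by positivity) (by have := Finset.mem_range.mp hr; omega)
    have := hmod.eq
    omega

lemma exists_eq_sum_theta (hm : 0 < m) {τ : ℍ}
    (hs : ∀ z, HasSum (fun r : ℤ => a r * 𝐞(r * z)) (f z))
    (hf : ∀ z, f (z + τ) = 𝐞(-(m * (τ + 2 * z))) * f z) :
    ∃ b : ℕ → ℂ, ∀ z, f z = ∑ r ∈ Finset.range (2 * m), b r * theta m r τ z := by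
  have hm' : (m : ℂ) ≠ 0 := by exact_mod_cast hm.ne'
  set b : ℤ → ℂ := fun r => a r * 𝐞(-((r : ℂ) ^ 2 / (4 * m) * τ)) with hb
  have hper : Function.Periodic b (2 * m) := fun r => by
    simp only [hb]
    rw [coeff_add_two_mul hs hf, mul_comm _ (a r), mul_assoc, ← Complex.exp_add]
    congr 2
    push_cast
    field_simp
    ring
  have hab (r : ℤ) (z : ℂ) : a r * 𝐞(r * z) = b r * 𝐞((r : ℂ) ^ 2 / (4 * m) * τ + r * z) := by
    simp only [hb]
    rw [mul_assoc (a r), ← Complex.exp_add]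
    congr 2
    ring
  refine ⟨fun r => b r, fun z => (hs z).unique ?_⟩
  refine (hasSum_sum fun r _ => (hasSum_theta hm r τ z).mul_left (b r)).congr_fun fun p => ?_
  rw [hab, ← sum_mul_thetaCoeff hm hper, Finset.sum_mul]
  simp only [mul_assoc]

lemma HasJacobiExpansion.exists_hasSum {φ : ℍ → ℂ → ℂ} (hφ : HasJacobiExpansion m φ) (τ : ℍ) :
    ∃ a : ℤ → ℂ, ∀ z, HasSum (fun r : ℤ => a r * 𝐞(r * z)) (φ τ z) := by
  obtain ⟨h, c, -, -, hs⟩ := hφ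
  refine ⟨fun r => ∑' n : ℤ, c (n, r) * 𝐞((n : ℂ) / h * τ), fun z => ?_⟩
  have hswap := (Equiv.prodComm ℤ ℤ).hasSum_iff.mpr (hs τ z)
  refine (hswap.prod_fiberwise fun r => (hswap.summable.prod_factor r).hasSum).congr_fun
    fun r => ?_
  rw [← tsum_mul_right]
  refine tsum_congr fun n => ?_
  rw [mul_assoc, ← Complex.exp_add, ← mul_add]
  rfl

lemma jacobiSlash_one (k : ℤ) (φ : ℍ → ℂ → ℂ) : jacobiSlash k m 1 φ = φ := by
  ext τ z
  simp [jacobiSlash, autFactor]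

lemma exists_isThetaDecomposition (hm : 0 < m) {k : ℤ} {M : ℕ} {ν : Gamma0 M →* ℂ}
    {φ : ℍ → ℂ → ℂ} (hφ : φ ∈ jacobiForms k m M ν) : ∃ h, IsThetaDecomposition m φ h := by
  obtain ⟨-, -, hell, hexp⟩ := hφ
  have hτ (τ : ℍ) :
      ∃ b : ℕ → ℂ, ∀ z, φ τ z = ∑ r ∈ Finset.range (2 * m), b r * theta m r τ z := by
    obtain ⟨a, ha⟩ := (jacobiSlash_one k φ ▸ hexp 1).exists_hasSum τ
    refine exists_eq_sum_theta hm ha fun z => ?_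
    simpa [mul_assoc] using hell 1 0 τ z
  choose b hb using hτ
  exact ⟨fun r τ => b τ r, hb⟩

lemma jacobiStar_one (k : ℤ) (M : ℕ) (ν : Gamma0 M →* ℂ) :
    jacobiStar k 1 M ν = jacobiForms k 1 M ν := by
  refine le_antisymm (fun φ hφ => hφ.1) fun φ hφ => ?_
  obtain ⟨h, hh⟩ := exists_isThetaDecomposition one_pos hφ
  exact ⟨hφ, h, hh, fun r _ _ _ => by omega⟩

end ThetaDecomposition

section JacobiExpansion

variable {m : ℕ} {φ : ℍ → ℂ → ℂ}

lemma HasJacobiExpansion.of_hasSum {ι : Type*} {h : ℕ} (c : ι → ℂ) (N R : ι → ℤ) (hh : 0 < h)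
    (hc : ∀ i, c i ≠ 0 → h * R i ^ 2 ≤ 4 * m * N i)
    (hs : ∀ (τ : ℍ) z, HasSum (fun i => c i * 𝐞((N i : ℂ) / h * τ + R i * z)) (φ τ z)) :
    HasJacobiExpansion m φ := by
  refine ⟨h, fun p => ∑' i : (fun i => (N i, R i)) ⁻¹' {p}, c i, hh, fun n r hn => ?_,
    fun τ z => ?_⟩
  · contrapose! hn
    refine (tsum_congr fun ⟨i, hi⟩ => ?_).trans tsum_zero
    obtain ⟨rfl, rfl⟩ := Prod.mk.inj hi
    exact by_contra fun hi => hn.not_ge (hc i hi)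
  · refine ((hs τ z).tsum_fiberwise fun i => (N i, R i)).congr_fun fun p => ?_
    rw [← tsum_mul_right]
    refine tsum_congr ?_
    rintro ⟨i, rfl⟩
    rfl

lemma HasJacobiExpansion.mul_left (hφ : HasJacobiExpansion m φ) {ι : Type*} {H : ℕ} (hH : 0 < H)
    {g : ℍ → ℂ} {α : ι → ℂ} {N : ι → ℕ}
    (hg : ∀ τ : ℍ, HasSum (fun i => α i * 𝐞((N i : ℂ) / H * τ)) (g τ)) :
    HasJacobiExpansion m (fun τ z => g τ * φ τ z) := by
  obtain ⟨h, c, hh, hc, hs⟩ := hφ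
  have hH' : (H : ℂ) ≠ 0 := by exact_mod_cast hH.ne'
  have hh' : (h : ℂ) ≠ 0 := by exact_mod_cast hh.ne'
  refine .of_hasSum (h := H * h) (fun i : ι × ℤ × ℤ => α i.1 * c i.2)
    (fun i => h * N i.1 + H * i.2.1) (fun i => i.2.2) (by positivity) (fun i hi => ?_)
    fun τ z => ?_
  · have hsq := mul_le_mul_of_nonneg_left (hc _ _ (right_ne_zero_of_mul hi)) (Int.natCast_nonneg H)
    have hpos : (0 : ℤ) ≤ 4 * m * (h * N i.1) := by positivity
    push_cast
    linarith
  · have hmul := summable_mul_of_summable_norm (hg τ).summable.norm (hs τ z).summable.norm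
    refine ((hg τ).mul (hs τ z) hmul).congr_fun fun i => ?_
    rw [mul_mul_mul_comm, ← Complex.exp_add]
    congr 2
    push_cast
    field_simp
    ring

lemma HasJacobiExpansion.comp_affineMap (hφ : HasJacobiExpansion m φ) {a d : ℕ} (ha : 0 < a)
    (hd : 0 < d) (b : ℤ) :
    HasJacobiExpansion (a * d * m) (fun τ z => φ (affineMap a d b τ) (a * z)) := by
  obtain ⟨h, c, hh, hc, hs⟩ := hφ
  have hd' : (d : ℂ) ≠ 0 := by exact_mod_cast hd.ne'
  have hh' : (h : ℂ) ≠ 0 := by exact_mod_cast hh.ne'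
  refine .of_hasSum (h := h * d) (fun p => c p * 𝐞((p.1 : ℂ) / h * (b / d))) (fun p => a * p.1)
    (fun p => a * p.2) (by positivity) (fun p hp => ?_) fun τ z => ?_
  · have hsq := mul_le_mul_of_nonneg_left (hc _ _ (left_ne_zero_of_mul hp))
      (show (0 : ℤ) ≤ d * a ^ 2 by positivity)
    push_cast
    linarith
  · refine (hs (affineMap a d b τ) (a * z)).congr_fun fun p => ?_
    rw [coe_affineMap ha hd, mul_assoc, ← Complex.exp_add]
    congr 2
    push_cast
    field_simp
    ring

lemma hasJacobiExpansion_theta (hm : 0 < m) (r : ℕ) : HasJacobiExpansion m (theta m r) :=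
  .of_hasSum (h := 4 * m) (thetaCoeff m r) (fun p => p ^ 2) id (by positivity)
    (fun p _ => by simp) fun τ z => by simpa using hasSum_theta hm r τ z

lemma hasSum_theta_apply_zero (hm : 0 < m) (r : ℕ) (τ : ℍ) :
    HasSum (fun p : ℤ => thetaCoeff m r p * 𝐞(((p.natAbs ^ 2 : ℕ) : ℂ) / (4 * m : ℕ) * τ))
      (theta m r τ 0) :=
  (hasSum_theta hm r τ 0).congr_fun fun p => by
    rw [mul_zero, add_zero, Nat.cast_pow, Nat.cast_natAbs, ← Int.cast_pow, sq_abs]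
    push_cast
    rfl

lemma hasJacobiExpansion_thetaDet (hm : 0 < m) : HasJacobiExpansion m (thetaDet m) := by
  have hterm (r s : ℕ) : HasJacobiExpansion m (fun τ z => theta m r τ 0 * theta m s τ z) :=
    (hasJacobiExpansion_theta hm s).mul_left (H := 4 * m) (by positivity)
      (hasSum_theta_apply_zero hm r)
  convert (hterm m 0).add ((hterm 0 m).smul (-1)) using 1
  ext τ z
  simp only [thetaDet, Pi.add_apply, Pi.smul_apply, smul_eq_mul]
  ring

end JacobiExpansion

section Cusps

lemma fourierCoeffOn_comp_natCast_mul {a : ℤ → ℂ} {f : ℂ → ℂ}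
    (hf : ∀ z, HasSum (fun r : ℤ => a r * 𝐞(r * z)) (f z)) {n : ℕ} (hn : 0 < n) (s : ℤ) :
    fourierCoeffOn zero_lt_one (fun x : ℝ => f (n * x)) (n * s) = a s := by
  have hn' : (n : ℤ) ≠ 0 := by exact_mod_cast hn.ne'
  have hcomp (z : ℂ) : HasSum (fun r : ℤ => a r * 𝐞((n * r : ℤ) * z)) (f (n * z)) :=
    (hf (n * z)).congr_fun fun r => by
      congr 2
      push_cast
      ring
  refine (hasSum_fourierCoeffOn (f := fun z => f (n * z)) hcomp (n * s)).unique <|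
    (hasSum_ite_eq s (a s)).congr_fun fun r => ?_
  simp only [mul_right_inj' hn']
  split_ifs with h <;> simp_all

lemma hasSum_thetaDet {m : ℕ} (hm : 0 < m) (τ : ℍ) (z : ℂ) :
    HasSum (fun p : ℤ => (theta m m τ 0 * thetaCoeff m 0 p - theta m 0 τ 0 * thetaCoeff m m p) *
      𝐞((p : ℂ) ^ 2 / (4 * m) * τ) * 𝐞(p * z)) (thetaDet m τ z) :=
  (((hasSum_theta hm 0 τ z).mul_left _).sub ((hasSum_theta hm m τ z).mul_left _)).congr_fun
    fun p => by
      rw [mul_add (2 * π * Complex.I), Complex.exp_add]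
      ring

lemma fourierCoeffOn_thetaDet_one {a : ℕ} (ha : 0 < a) (τ : ℍ) :
    fourierCoeffOn zero_lt_one (fun x : ℝ => thetaDet 1 τ (a * x)) a =
      -(theta 1 0 τ 0 * 𝐞((τ : ℂ) / 4)) := by
  have hcoeff := fourierCoeffOn_comp_natCast_mul (hasSum_thetaDet one_pos τ) ha 1
  rw [mul_one] at hcoeff
  rw [hcoeff]
  simp [thetaCoeff, Int.modEq_iff_dvd, div_eq_inv_mul]

lemma norm_exp_two_pi_I_mul (t : ℝ) (τ : ℍ) :
    ‖𝐞(t * τ)‖ = Real.exp (-(2 * π * t * τ.im)) := by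
  rw [Complex.norm_exp]
  congr 1
  simp [mul_assoc]

lemma HasJacobiExpansion.exists_norm_fourierCoeffOn_le {m : ℕ} (hm : 0 < m) {φ : ℍ → ℂ → ℂ}
    (hφ : HasJacobiExpansion m φ) (s : ℤ) : ∃ C, ∀ τ : ℍ, 1 ≤ τ.im →
      ‖fourierCoeffOn zero_lt_one (fun x : ℝ => φ τ x) s‖ ≤
        C * Real.exp (-(2 * π * ((s : ℝ) ^ 2 / (4 * m)) * τ.im)) := by
  obtain ⟨h, c, hh, hc, hs⟩ := hφ
  have hnorm (n : ℤ) (τ : ℍ) :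
      ‖𝐞((n : ℂ) / h * τ)‖ = Real.exp (-(2 * π * ((n : ℝ) / h) * τ.im)) := by
    rw [← norm_exp_two_pi_I_mul]
    push_cast
    rfl
  have hcoeff (τ : ℍ) : HasSum (fun p : ℤ × ℤ => if p.2 = s then c p * 𝐞((p.1 : ℂ) / h * τ) else 0)
      (fourierCoeffOn zero_lt_one (fun x : ℝ => φ τ x) s) :=
    hasSum_fourierCoeffOn (fun z => (hs τ z).congr_fun fun p => by
      rw [mul_assoc, ← Complex.exp_add, mul_add]) s
  set ρ : ℝ := (s : ℝ) ^ 2 / (4 * m)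
  refine ⟨_, fun τ hτ => ((hcoeff τ).norm_le_of_bounded
    (((hcoeff I).summable.norm.hasSum.mul_right (Real.exp (2 * π * ρ))).mul_right
      (Real.exp (-(2 * π * ρ * τ.im)))) fun p => ?_)⟩
  split_ifs with hp
  · by_cases h0 : c p = 0
    · simp [h0]
    have hρ : ρ ≤ p.1 / h := by
      have hps : (h : ℝ) * s ^ 2 ≤ 4 * m * p.1 := by exact_mod_cast hp ▸ hc p.1 p.2 h0
      rw [div_le_div_iff₀ (by positivity) (by positivity)]
      linarith
    have hmono := mul_nonneg Real.two_pi_pos.le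
      (mul_nonneg (sub_nonneg.mpr hρ) (sub_nonneg.mpr hτ))
    rw [norm_mul, norm_mul, hnorm, hnorm, I_im, mul_assoc ‖c p‖, mul_assoc ‖c p‖,
      ← Real.exp_add, ← Real.exp_add]
    gcongr
    linarith
  · simp

lemma isBoundedAtImInfty_of_hasJacobiExpansion {f : ℍ → ℂ} {a d : ℕ} (ha : 0 < a) (hd : 0 < d)
    (b : ℤ) {κ : ℂ} (hκ : κ ≠ 0) (hφ : HasJacobiExpansion (a * d)
      (fun τ z => f τ * (κ * thetaDet 1 (affineMap a d b τ) (a * z)))) :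
    IsBoundedAtImInfty f := by
  have haR : (1 : ℝ) ≤ a := by exact_mod_cast ha
  have hdR : (1 : ℝ) ≤ d := by exact_mod_cast hd
  obtain ⟨C, hC⟩ := hφ.exists_norm_fourierCoeffOn_le (Nat.mul_pos ha hd) a
  rw [isBoundedAtImInfty_iff]
  refine ⟨2 * C / ‖κ‖, d, fun τ hτ => ?_⟩
  have him : (affineMap a d b τ).im = a / d * τ.im := by
    rw [← coe_im, coe_affineMap ha hd, Complex.div_natCast_im]
    simp [div_mul_eq_mul_div]
  have hθ : 1 / 2 < ‖theta 1 0 (affineMap a d b τ) 0‖ := by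
    refine half_lt_norm_theta_zero ?_
    rw [him, div_mul_eq_mul_div, le_div_iff₀ (by positivity)]
    nlinarith
  have hq : ‖𝐞((affineMap a d b τ : ℂ) / 4)‖ =
      Real.exp (-(2 * π * (((a : ℤ) : ℝ) ^ 2 / (4 * (a * d : ℕ))) * τ.im)) := by
    rw [show (affineMap a d b τ : ℂ) / 4 = (1 / 4 : ℝ) * affineMap a d b τ by push_cast; ring,
      norm_exp_two_pi_I_mul, him]
    congr 1
    push_cast
    field_simp
  have hle := hC τ (hdR.trans hτ)
  rw [fourierCoeffOn.const_mul, fourierCoeffOn.const_mul, fourierCoeffOn_thetaDet_one ha, norm_mul,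
    norm_mul, norm_neg, norm_mul, hq, ← mul_assoc, ← mul_assoc] at hle
  have hfκ : ‖f τ‖ * ‖κ‖ * ‖theta 1 0 (affineMap a d b τ) 0‖ ≤ C :=
    le_of_mul_le_mul_right hle (Real.exp_pos _)
  rw [le_div_iff₀ (norm_pos_iff.mpr hκ)]
  nlinarith [mul_nonneg (norm_nonneg (f τ)) (norm_nonneg κ)]

end Cusps

section Characters

lemma map_pow_twelve {G : Type*} [CommMonoid G] (f : SL(2, ℤ) →* G) (γ : SL(2, ℤ)) :
    f γ ^ 12 = 1 := by
  set s := f ModularGroup.S with hs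
  set t := f ModularGroup.T with ht
  have hs4 : s ^ 4 = 1 := by
    rw [hs, ← map_pow, show ModularGroup.S ^ 4 = 1 by decide, map_one]
  have hst : (s * t) ^ 3 = s ^ 2 := by
    rw [hs, ht, ← map_mul, ← map_pow, ← map_pow,
      show (ModularGroup.S * ModularGroup.T) ^ 3 = ModularGroup.S ^ 2 by decide]
  have hs12 : s ^ 12 = 1 := by rw [show 12 = 4 * 3 from rfl, pow_mul, hs4, one_pow]
  have ht12 : t ^ 12 = 1 := calc
    t ^ 12 = ((s * t) ^ 3) ^ 4 := by rw [← pow_mul, mul_pow, hs12, one_mul]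
    _ = (s ^ 4) ^ 2 := by rw [hst, ← pow_mul, ← pow_mul]
    _ = 1 := by rw [hs4, one_pow]
  have hpow : (powMonoidHom 12).comp f = 1 :=
    MonoidHom.eq_of_eqOn_dense SpecialLinearGroup.SL2Z_generators <| by
      rintro _ (rfl | rfl)
      exacts [hs12, ht12]
  exact DFunLike.congr_fun hpow γ

lemma isOfFinOrder_restrictChar_omega {m M : ℕ} (h : m ∣ M) :
    IsOfFinOrder (restrictChar h (omega m)) :=
  isOfFinOrder_iff_pow_eq_one.mpr
    ⟨12, by norm_num, MonoidHom.ext fun _ => map_pow_twelve detThetaMultiplier _⟩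

lemma isOfFinOrder_dirichletChar {M : ℕ} (hM : 0 < M) (χ : DirichletCharacter ℂ M) :
    IsOfFinOrder (dirichletChar χ) := by
  have : NeZero M := ⟨hM.ne'⟩
  refine isOfFinOrder_iff_pow_eq_one.mpr ⟨Fintype.card (ZMod M)ˣ, Fintype.card_pos, ?_⟩
  ext γ
  obtain ⟨u, hu⟩ := (Group.isUnit γ).map (Gamma0Map M)
  change χ (Gamma0Map M γ) ^ _ = 1
  rw [← hu, ← MulChar.pow_apply_coe, MulChar.pow_card_eq_one, MulChar.one_apply_coe]

variable {M : ℕ} {ν : Gamma0 M →* ℂ}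

lemma isOfFinOrder_conjChar (hν : IsOfFinOrder ν) : IsOfFinOrder (conjChar ν) := by
  obtain ⟨n, hn, hpow⟩ := isOfFinOrder_iff_pow_eq_one.mp hν
  refine isOfFinOrder_iff_pow_eq_one.mpr ⟨n, hn, MonoidHom.ext fun γ => ?_⟩
  change starRingEnd ℂ (ν γ) ^ n = 1
  rw [← map_pow, ← MonoidHom.pow_apply, hpow, MonoidHom.one_apply, map_one]

lemma conjChar_mul_self (hν : IsOfFinOrder ν) : conjChar ν * ν = 1 := by
  obtain ⟨n, hn, hpow⟩ := isOfFinOrder_iff_pow_eq_one.mp hν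
  ext γ
  have hnorm : ‖ν γ‖ = 1 :=
    Complex.norm_eq_one_of_pow_eq_one (DFunLike.congr_fun hpow γ) hn.ne'
  change starRingEnd ℂ (ν γ) * ν γ = 1
  rw [Complex.conj_mul', hnorm, Complex.ofReal_one, one_pow]

end Characters

section QExpansion

lemma slash_eq_autFactor (k : ℤ) (f : ℍ → ℂ) (g : SL(2, ℤ)) (τ : ℍ) :
    (f ∣[k] g) τ = autFactor g τ ^ (-k) * f (g • τ) := by
  rw [ModularForm.SL_slash_apply, mul_comm, autFactor_eq_denom]

lemma periodic_comp_ofComplex {f : ℍ → ℂ} {h : ℝ} (hf : ∀ τ : ℍ, f (h +ᵥ τ) = f τ) :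
    Function.Periodic (f ∘ ofComplex) h := by
  intro w
  by_cases! hw : 0 < w.im
  · have hw' : 0 < (w + h).im := by simpa using hw
    simp only [Function.comp_apply, ofComplex_apply_of_im_pos hw',
      ofComplex_apply_of_im_pos hw, ← hf ⟨w, hw⟩]
    congr 1
    ext
    simp [add_comm]
  · have hw' : (w + h).im ≤ 0 := by simpa using hw
    simp [ofComplex_apply_of_im_nonpos hw, ofComplex_apply_of_im_nonpos hw']

lemma slash_T_pow_apply (k : ℤ) (f : ℍ → ℂ) (n : ℕ) (τ : ℍ) :
    (f ∣[k] (ModularGroup.T ^ n)) τ = f ((n : ℝ) +ᵥ τ) := by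
  have hsmul := UpperHalfPlane.modular_T_zpow_smul τ n
  have hcoe := ModularGroup.coe_T_zpow n
  rw [zpow_natCast] at hsmul hcoe
  have hfactor : autFactor (ModularGroup.T ^ n) τ = 1 := by simp [autFactor, hcoe]
  rw [slash_eq_autFactor, hfactor, one_zpow, one_mul, hsmul, Int.cast_natCast]

lemma exists_hasSum_of_slash_T_pow {k : ℤ} {f : ℍ → ℂ} {H : ℕ} (hH : 0 < H) (hf : MDiff f)
    (hT : f ∣[k] (ModularGroup.T ^ H) = f) (hbdd : IsBoundedAtImInfty f) :
    ∃ α : ℕ → ℂ, ∀ τ : ℍ, HasSum (fun n : ℕ => α n * 𝐞((n : ℂ) / H * τ)) (f τ) := by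
  have hper : Function.Periodic (f ∘ ofComplex) (H : ℝ) :=
    periodic_comp_ofComplex fun τ => by rw [← slash_T_pow_apply k f, hT]
  refine ⟨fun n => (qExpansion H f).coeff n, fun τ =>
    (hasSum_qExpansion (Nat.cast_pos.mpr hH) hper hf hbdd τ).congr_fun fun n => ?_⟩
  rw [smul_eq_mul, Function.Periodic.qParam, ← Complex.exp_nat_mul]
  congr 2
  push_cast
  ring

lemma conj_T_pow_mem_Gamma0 (M : ℕ) (g : SL(2, ℤ)) :
    g * ModularGroup.T ^ M * g⁻¹ ∈ Gamma0 M := by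
  have hT : ModularGroup.T ^ M ∈ Gamma M := by
    simpa using ModularGroup_T_pow_mem_Gamma M M dvd_rfl
  exact Gamma0_mem.mpr (Gamma_mem.mp ((Gamma_normal M).conj_mem _ hT g)).2.2.1

variable {k : ℤ} {M : ℕ} {ν : Gamma0 M →* ℂ} {f : ℍ → ℂ}

lemma smul_eq_iff_slash_eq (γ : Gamma0 M) :
    (∀ τ : ℍ, f ((γ : SL(2, ℤ)) • τ) = ν γ * autFactor γ τ ^ k * f τ) ↔
      f ∣[k] (γ : SL(2, ℤ)) = ν γ • f := by
  refine Iff.trans (forall_congr' fun τ => ?_) funext_iff.symm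
  rw [slash_eq_autFactor, zpow_neg, inv_mul_eq_iff_eq_mul₀ (zpow_ne_zero k (autFactor_ne_zero _ τ)),
    Pi.smul_apply, smul_eq_mul, mul_left_comm, mul_assoc]

lemma exists_hasSum_slash (hM : 0 < M) (hν : IsOfFinOrder ν) (hf : f ∈ modularForms k M ν)
    (g : SL(2, ℤ)) : ∃ H : ℕ, 0 < H ∧ ∃ α : ℕ → ℂ, ∀ τ : ℍ,
      HasSum (fun n : ℕ => α n * 𝐞((n : ℂ) / H * τ)) ((f ∣[k] g) τ) := by
  obtain ⟨hhol, hmod, hbdd⟩ := hf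
  obtain ⟨n, hn, hpow⟩ := isOfFinOrder_iff_pow_eq_one.mp hν
  refine ⟨M * n, Nat.mul_pos hM hn,
    exists_hasSum_of_slash_T_pow (k := k) (Nat.mul_pos hM hn) (hhol.slash k _) ?_ (hbdd g)⟩
  set γ : Gamma0 M := ⟨_, conj_T_pow_mem_Gamma0 M g⟩ with hγ
  have hγn : ((γ ^ n : Gamma0 M) : SL(2, ℤ)) = g * ModularGroup.T ^ (M * n) * g⁻¹ := by
    rw [Subgroup.coe_pow, hγ, conj_pow, pow_mul]
  have hνn : ν (γ ^ n) = 1 := by rw [map_pow, ← MonoidHom.pow_apply, hpow, MonoidHom.one_apply]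
  have hinv : f ∣[k] (g * ModularGroup.T ^ (M * n) * g⁻¹) = f := by
    rw [← hγn, (smul_eq_iff_slash_eq _).mp (hmod (γ ^ n)), hνn, one_smul]
  rw [← SlashAction.slash_mul, ← inv_mul_cancel_right (g * ModularGroup.T ^ (M * n)) g,
    SlashAction.slash_mul, hinv]

end QExpansion

lemma IsHolomorphic.differentiableAt_apply {ψ : ℍ → ℂ → ℂ} (hψ : IsHolomorphic ψ) (z : ℂ) {w : ℂ}
    (hw : 0 < w.im) : DifferentiableAt ℂ (fun w => ψ (ofComplex w) z) w :=
  have hopen : IsOpen {p : ℂ × ℂ | 0 < p.1.im} :=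
    isOpen_lt continuous_const (Complex.continuous_im.comp continuous_fst)
  (DifferentiableOn.differentiableAt (x := (w, z)) hψ (hopen.mem_nhds hw)).comp
    (f := fun w => (w, z)) w (by fun_prop)

lemma IsHolomorphic.mdifferentiable_of_mul {ψ : ℍ → ℂ → ℂ} (hψ : IsHolomorphic ψ)
    {f : ℍ → ℂ} (hne : ∀ τ, ∃ z, ψ τ z ≠ 0) (hfψ : IsHolomorphic fun τ z => f τ * ψ τ z) :
    MDiff f := by
  refine UpperHalfPlane.mdifferentiable_iff.mpr fun w hw =>
    DifferentiableAt.differentiableWithinAt ?_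
  obtain ⟨z, hz⟩ := hne (ofComplex w)
  have hdenom := hψ.differentiableAt_apply z hw
  refine ((hfψ.differentiableAt_apply z hw).div hdenom hz).congr_of_eventuallyEq ?_
  filter_upwards [hdenom.continuousAt.eventually_ne hz] with v hv
  exact (mul_div_cancel_right₀ _ hv).symm

lemma IsHolomorphic.mul_left {ψ : ℍ → ℂ → ℂ} (hψ : IsHolomorphic ψ) {f : ℍ → ℂ} (hf : MDiff f) :
    IsHolomorphic fun τ z => f τ * ψ τ z :=
  have hfst : DifferentiableOn ℂ (fun p : ℂ × ℂ => f (ofComplex p.1)) {p | 0 < p.1.im} :=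
    (UpperHalfPlane.mdifferentiable_iff.mp hf).comp (f := Prod.fst) differentiableOn_fst
      fun _ hp => hp
  hfst.mul hψ

lemma exists_eq_mul_and_eq_neg_mul {K : Type*} [Field K] {x y u v : K}
    (h : x * u + y * v = 0) (huv : v ≠ 0 ∨ u ≠ 0) : ∃ c, x = c * v ∧ y = -(c * u) := by
  rcases huv with hv | hu
  · refine ⟨x / v, (div_mul_cancel₀ x hv).symm, ?_⟩
    field_simp
    linear_combination h
  · refine ⟨-(y / u), ?_, by rw [neg_mul, neg_neg, div_mul_cancel₀ y hu]⟩
    field_simp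
    linear_combination h

lemma jacobiSlash_mul (k : ℤ) (m : ℕ) (g : SL(2, ℤ)) (f : ℍ → ℂ) (ψ : ℍ → ℂ → ℂ) (τ : ℍ) (z : ℂ) :
    jacobiSlash k m g (fun τ z => f τ * ψ τ z) τ z =
      (f ∣[k - 1] g) τ * jacobiSlash 1 m g ψ τ z := by
  rw [slash_eq_autFactor, jacobiSlash, jacobiSlash,
    show -k = -(k - 1) + -1 by ring, zpow_add₀ (autFactor_ne_zero g τ)]
  ring

/-- Multiplication of a function on `ℍ` by the determinant `thetaDet m`, as a linear map. On
modular forms it is the isomorphism onto the kernel of the restriction map. -/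
def mulThetaDet (m : ℕ) : (ℍ → ℂ) →ₗ[ℂ] (ℍ → ℂ → ℂ) where
  toFun f τ z := f τ * thetaDet m τ z
  map_add' f g := by ext τ z; exact add_mul _ _ _
  map_smul' a f := by ext τ z; exact mul_assoc _ _ _

section MulThetaDet

variable {k : ℤ} {m M : ℕ} {ν : Gamma0 M →* ℂ} {f : ℍ → ℂ}

lemma mulThetaDet_apply (m : ℕ) (f : ℍ → ℂ) (τ : ℍ) (z : ℂ) :
    mulThetaDet m f τ z = f τ * thetaDet m τ z := rfl

lemma mulThetaDet_injective (hm : 0 < m) : Function.Injective (mulThetaDet m) := by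
  intro f g h
  ext τ
  obtain ⟨z, hz⟩ := exists_thetaDet_ne_zero hm τ
  exact mul_right_cancel₀ hz (congrFun₂ h τ z)

lemma exists_mulThetaDet_eq (hm : 0 < m) {φ : ℍ → ℂ → ℂ} {h : ℕ → ℍ → ℂ}
    (hφ : IsThetaDecomposition m φ h) (h0 : ∀ r < 2 * m, r ≠ 0 → r ≠ m → h r = 0)
    (hker : ∀ τ, φ τ 0 = 0) : ∃ f, mulThetaDet m f = φ := by
  have hsum (τ : ℍ) (z : ℂ) : φ τ z = h 0 τ * theta m 0 τ z + h m τ * theta m m τ z := by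
    rw [hφ, Finset.sum_eq_add_of_mem 0 m (by simp; omega) (by simp; omega) hm.ne fun r hr hr' => by
      rw [h0 r (Finset.mem_range.mp hr) hr'.1 hr'.2, Pi.zero_apply, zero_mul]]
  have hcoeff (τ : ℍ) : ∃ c, h 0 τ = c * theta m m τ 0 ∧ h m τ = -(c * theta m 0 τ 0) :=
    exists_eq_mul_and_eq_neg_mul ((hsum τ 0).symm.trans (hker τ))
      (theta_self_ne_zero_or_theta_zero_ne_zero hm τ)
  choose f hf0 hfm using hcoeff
  refine ⟨f, funext₂ fun τ z => ?_⟩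
  rw [hsum, hf0, hfm, mulThetaDet_apply, thetaDet]
  ring

lemma isThetaDecomposition_mulThetaDet (hm : 0 < m) (f : ℍ → ℂ) :
    IsThetaDecomposition m (mulThetaDet m f)
      (Pi.single 0 (fun τ => f τ * theta m m τ 0) + Pi.single m fun τ => -(f τ * theta m 0 τ 0)) :=
  fun τ z => by
    rw [Finset.sum_eq_add_of_mem 0 m (by simp; omega) (by simp; omega) hm.ne fun r _ hr => by
      simp [hr.1, hr.2]]
    simp only [mulThetaDet_apply, thetaDet, Pi.add_apply, Pi.single_eq_same,
      Pi.single_eq_of_ne hm.ne, Pi.single_eq_of_ne hm.ne', Pi.zero_apply]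
    ring

lemma mulThetaDet_mem_ker (m : ℕ) (f : ℍ → ℂ) :
    mulThetaDet m f ∈ LinearMap.ker restrictionMap :=
  funext fun τ => by
    change f τ * thetaDet m τ 0 = 0
    rw [thetaDet_apply_zero, mul_zero]

lemma IsHermiteDecomposition.jacobiSlash_mulThetaDet {g g' : SL(2, ℤ)} {a d : ℕ} {b : ℤ}
    (h : IsHermiteDecomposition m g g' a d b) (k : ℤ) (f : ℍ → ℂ) :
    jacobiSlash k m g (mulThetaDet m f) = fun τ z => (f ∣[k - 1] g) τ *
      (detThetaMultiplier g' / d * thetaDet 1 (affineMap a d b τ) (a * z)) :=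
  funext₂ fun τ z => by
    rw [← h.jacobiSlash_thetaDet]
    exact jacobiSlash_mul k m g f (thetaDet m) τ z

lemma jacobiSlash_mulThetaDet_eq_iff (hm : 0 < m) (h : m ∣ M) (ν : Gamma0 M →* ℂ) (f : ℍ → ℂ)
    (γ : Gamma0 M) :
    jacobiSlash k m γ (mulThetaDet m f) = (ν * restrictChar h (omega m)) γ • mulThetaDet m f ↔
      f ∣[k - 1] (γ : SL(2, ℤ)) = ν γ • f := by
  have hω : restrictChar h (omega m) γ ≠ 0 :=
    ((Group.isUnit γ).map (restrictChar h (omega m))).ne_zero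
  have hslash : jacobiSlash k m γ (mulThetaDet m f) =
      restrictChar h (omega m) γ • mulThetaDet m (f ∣[k - 1] (γ : SL(2, ℤ))) := by
    ext τ z
    refine (jacobiSlash_mul k m γ f (thetaDet m) τ z).trans ?_
    have hdet := jacobiSlash_thetaDet_Gamma0 hm (Subgroup.inclusion (Gamma0_le_of_dvd h) γ) τ z
    rw [Subgroup.coe_inclusion] at hdet
    rw [hdet]
    exact mul_left_comm _ _ _
  rw [hslash, MonoidHom.mul_apply, mul_comm (ν γ), mul_smul,
    (smul_right_injective _ hω).eq_iff, ← map_smul, (mulThetaDet_injective hm).eq_iff]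

lemma mulThetaDet_mem_jacobiForms (hM : 0 < M) (h : m ∣ M) (hν : IsOfFinOrder ν)
    (hf : f ∈ modularForms (k - 1) M ν) :
    mulThetaDet m f ∈ jacobiForms k m M (ν * restrictChar h (omega m)) := by
  have hm : 0 < m := Nat.pos_of_dvd_of_pos h hM
  refine ⟨(isHolomorphic_thetaDet hm).mul_left hf.1, fun γ => ?_, fun l u τ z => ?_,
    fun g => ?_⟩
  · exact (jacobiSlash_mulThetaDet_eq_iff hm h ν f γ).mpr ((smul_eq_iff_slash_eq γ).mp (hf.2.1 γ))
  · rw [mulThetaDet_apply, thetaDet_elliptic hm, mul_left_comm, mulThetaDet_apply]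
  · obtain ⟨g', a, d, b, hg⟩ := exists_isHermiteDecomposition hm g
    obtain ⟨H, hH, α, hα⟩ := exists_hasSum_slash hM hν hf g
    have hdet := (hasJacobiExpansion_thetaDet one_pos).comp_affineMap hg.pos_left hg.pos_right b
    rw [mul_one, hg.mul_eq] at hdet
    rw [hg.jacobiSlash_mulThetaDet]
    exact (hdet.smul (detThetaMultiplier g' / d)).mul_left hH hα

lemma mem_modularForms_of_mulThetaDet_mem (hm : 0 < m) (h : m ∣ M)
    (hf : mulThetaDet m f ∈ jacobiForms k m M (ν * restrictChar h (omega m))) :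
    f ∈ modularForms (k - 1) M ν := by
  obtain ⟨hhol, hslash, -, hcusp⟩ := hf
  refine ⟨(isHolomorphic_thetaDet hm).mdifferentiable_of_mul (exists_thetaDet_ne_zero hm) hhol,
    fun γ => ?_, fun g => ?_⟩
  · exact (smul_eq_iff_slash_eq γ).mpr ((jacobiSlash_mulThetaDet_eq_iff hm h ν f γ).mp (hslash γ))
  · obtain ⟨g', a, d, b, hg⟩ := exists_isHermiteDecomposition hm g
    have hκ : detThetaMultiplier g' / d ≠ 0 :=
      div_ne_zero ((Group.isUnit g').map detThetaMultiplier).ne_zero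
        (Nat.cast_ne_zero.mpr hg.pos_right.ne')
    have hexp := hcusp g
    rw [hg.jacobiSlash_mulThetaDet, ← hg.mul_eq] at hexp
    exact isBoundedAtImInfty_of_hasJacobiExpansion hg.pos_left hg.pos_right b hκ hexp

theorem map_mulThetaDet (k : ℤ) (hM : 0 < M) (h : m ∣ M) (hν : IsOfFinOrder ν) :
    (modularForms (k - 1) M ν).map (mulThetaDet m) =
      jacobiStarKernel k m M (ν * restrictChar h (omega m)) := by
  have hm : 0 < m := Nat.pos_of_dvd_of_pos h hM
  ext φ
  constructor
  · rintro ⟨f, hf, rfl⟩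
    exact ⟨⟨mulThetaDet_mem_jacobiForms hM h hν hf, _, isThetaDecomposition_mulThetaDet hm f,
      fun r _ h0 hr => by simp [h0, hr]⟩, mulThetaDet_mem_ker m f⟩
  · rintro ⟨⟨hφ, l, hl, hl0⟩, hker⟩
    obtain ⟨f, rfl⟩ := exists_mulThetaDet_eq hm hl hl0 (congrFun hker)
    exact ⟨f, mem_modularForms_of_mulThetaDet_mem hm h hφ, rfl⟩

/-- Multiplication by `thetaDet m` as an isomorphism from the modular forms of weight `k - 1` and
character `ν` onto the space `J*_{k,m}(Γ₀(M), ν ω_m)^0`. -/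
def modularFormsEquivJacobiStarKernel (k : ℤ) (hM : 0 < M) (h : m ∣ M) (hν : IsOfFinOrder ν) :
    modularForms (k - 1) M ν ≃ₗ[ℂ] jacobiStarKernel k m M (ν * restrictChar h (omega m)) :=
  (Submodule.equivMapOfInjective (mulThetaDet m)
    (mulThetaDet_injective (Nat.pos_of_dvd_of_pos h hM)) _).trans
      (LinearEquiv.ofEq _ _ (map_mulThetaDet k hM h hν))

lemma jacobiStarKernel_one (k : ℤ) (M : ℕ) (ν : Gamma0 M →* ℂ) :
    jacobiStarKernel k 1 M ν = jacobiKernel k 1 M ν := by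
  rw [jacobiStarKernel, jacobiStar_one, jacobiKernel]

end MulThetaDet

end

end JacobiRestriction

theorem corollary4p5_general (k : ℤ) {m M : ℕ} (hM : 0 < M) (h : m ∣ M) {ν : Gamma0 M →* ℂ}
    (hν : IsOfFinOrder ν) :
    Nonempty (jacobiKernel k 1 M ν ≃ₗ[ℂ]
      jacobiStarKernel k m M
        (ν * restrictChar h (omega m) * conjChar (restrictChar (one_dvd M) (omega 1)))) ∧
    Nonempty (jacobiKernel k 1 M ν ≃ₗ[ℂ]
      modularForms (k - 1) M (ν * conjChar (restrictChar (one_dvd M) (omega 1)))) ∧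
    Nonempty (jacobiStarKernel k m M
        (ν * restrictChar h (omega m) * conjChar (restrictChar (one_dvd M) (omega 1))) ≃ₗ[ℂ]
      modularForms (k - 1) M (ν * conjChar (restrictChar (one_dvd M) (omega 1)))) := by
  set ω := restrictChar (one_dvd M) (omega 1)
  have hω : IsOfFinOrder ω := isOfFinOrder_restrictChar_omega (one_dvd M)
  have hνω : IsOfFinOrder (ν * conjChar ω) := hν.mul (isOfFinOrder_conjChar hω)
  have hcancel : ν * conjChar ω * ω = ν := by rw [mul_assoc, conjChar_mul_self hω, mul_one]
  have e := modularFormsEquivJacobiStarKernel k hM (one_dvd M) hνω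
  rw [hcancel, jacobiStarKernel_one] at e
  have eStar := modularFormsEquivJacobiStarKernel k hM h hνω
  rw [mul_right_comm] at eStar
  exact ⟨⟨e.symm.trans eStar⟩, ⟨e.symm⟩, ⟨eStar.symm⟩⟩

theorem corollary4p5 (k : ℤ) (hk : 0 < k) (m N : ℕ) (hm : Squarefree m) (hN : 0 < N)
    (χ : DirichletCharacter ℂ (m * N)) :
    Nonempty (jacobiKernel k 1 (m * N) (dirichletChar χ) ≃ₗ[ℂ]
      jacobiStarKernel k m (m * N)
        (dirichletChar χ * restrictChar (Dvd.intro N rfl) (omega m) *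
          conjChar (restrictChar (one_dvd (m * N)) (omega 1)))) ∧
    Nonempty (jacobiKernel k 1 (m * N) (dirichletChar χ) ≃ₗ[ℂ]
      modularForms (k - 1) (m * N)
        (dirichletChar χ * conjChar (restrictChar (one_dvd (m * N)) (omega 1)))) ∧
    Nonempty (jacobiStarKernel k m (m * N)
        (dirichletChar χ * restrictChar (Dvd.intro N rfl) (omega m) *
          conjChar (restrictChar (one_dvd (m * N)) (omega 1))) ≃ₗ[ℂ]
      modularForms (k - 1) (m * N)
        (dirichletChar χ * conjChar (restrictChar (one_dvd (m * N)) (omega 1)))) := by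
  have hM : 0 < m * N := Nat.mul_pos (Nat.pos_of_ne_zero hm.ne_zero) hN
  exact corollary4p5_general k hM (Dvd.intro N rfl) (isOfFinOrder_dirichletChar hM χ)
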